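/- Let $(V,Y,\mathbf 1,\omega)$ be a vertex operator algebra over $\mathbb C$: $V=\bigoplus_{n\in\mathbb Z}V_n$ with $\dim V_n<\infty$ and $V_n=0$ for $n$ sufficiently small, $Y(u,z)=\sum_{n\in\mathbb Z}u_nz^{-n-1}$, $L(n)=\omega_{n+1}$, and $L(0)$ acts on $V_n$ as $n$; for $u\in V_n$ write $\mathrm{wt}\,u=n$. Let $g$ be an automorphism of $V$ of finite order $T$ (a linear automorphism with $gY(u,z)g^{-1}=Y(gu,z)$, $g\mathbf 1=\mathbf 1$, $g\omega=\omega$), and for $0\le r<T$ let $V^r=\{v\in V: gv=e^{2\pi i r/T}v\}$. Put $\delta_0=1$ and $\delta_r=0$ for $r\neq0$. For homogeneous $u\in V^r$ and for $v\in V$ define $$u\circ_g v=\mathrm{Res}_z\frac{(1+z)^{\mathrm{wt}\,u-1+\delta_r+r/T}}{z^{1+\delta_r}}Y(u,z)v,\qquad u*_gv=\begin{cases}\mathrm{Res}_z\dfrac{(1+z)^{\mathrm{wt}\,u}}{z}Y(u,z)v & r=0,\\[2mm] 0 & r>0,\end{cases}$$ where powers of $1+z$ are expanded in nonnegative powers of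 $z$, and extend $*_g$ linearly in $u$ to a bilinear product on $V$. Let $O_g(V)$ be the linear span of all $u\circ_gv$ and let $A_g(V)=V/O_g(V)$. Define $O_{g^{-1}}(V)$, $*_{g^{-1}}$ and $A_{g^{-1}}(V)$ in the same way from $g^{-1}$. (i) The product $*_g$ induces a well-defined bilinear associative product on $A_g(V)$ (and, likewise, $*_{g^{-1}}$ on $A_{g^{-1}}(V)$). (ii) The linear map $\phi:V\to V$, $\phi(a)=e^{L(1)}(-1)^{L(0)}a$, induces an anti-isomorphism $A_g(V)\to A_{g^{-1}}(V)$, that is, a linear bijection $\Phi$ with $\Phi(a+O_g(V))=\phi(a)+O_{g^{-1}}(V)$ for all $a\in V$ and $\Phi(xy)=\Phi(y)\Phi(x)$ for all $x,y\in A_g(V)$. (iii) For all $x\in V$, $$\mathbf 1*_gx\equiv x*_g\mathbf 1\equiv x \pmod{O_g(V)},\qquad \omega*_gx\equiv x*_g\omega\pmod{O_g(V)}.$$ -/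

import Mathlib

noncomputable section

/-- The mode `u_n` of the vertex operator `Y(u,z) = ∑_n u_n z^{-n-1}`. -/
abbrev vertexMode {V : Type*} [AddCommGroup V] [Module ℂ V]
    (Y : V →ₗ[ℂ] VertexOperator ℂ V) (u : V) (n : ℤ) : Module.End ℂ V :=
  VertexOperator.ncoeff (Y u) n

/-- A vertex operator algebra `(V, Y, 𝟏, ω)` over `ℂ`, graded by the integers, in the sense of
Frenkel-Lepowsky-Meurman and Frenkel-Huang-Lepowsky.  That `Y(u,z)v` is a Laurent series in `z`
with finitely many negative powers is part of the type `VertexOperator ℂ V`. -/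
structure VertexOperatorAlgebra (V : Type*) [AddCommGroup V] [Module ℂ V] where
  /-- the homogeneous subspaces `V_n` -/
  wt : ℤ → Submodule ℂ V
  /-- the state-field correspondence `u ↦ Y(u,z)` -/
  Y : V →ₗ[ℂ] VertexOperator ℂ V
  /-- the vacuum vector `𝟏` -/
  vacuum : V
  /-- the Virasoro vector `ω` -/
  omega : V
  /-- the central charge (rank) -/
  centralCharge : ℂ
  /-- `V = ⨁ V_n` -/
  isInternal : DirectSum.IsInternal wt
  finiteDimensional : ∀ n, FiniteDimensional ℂ (wt n)
  /-- `V_n = 0` for `n` sufficiently small -/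
  bounded_below : ∃ N : ℤ, ∀ n < N, wt n = ⊥
  vacuum_mem : vacuum ∈ wt 0
  omega_mem : omega ∈ wt 2
  /-- `Y(𝟏,z) = id` -/
  vacuum_mode : ∀ (n : ℤ) (v : V), vertexMode Y vacuum n v = if n = -1 then v else 0
  /-- `Y(u,z)𝟏` has no negative powers of `z` -/
  creation_nonneg : ∀ (u : V) (n : ℤ), 0 ≤ n → vertexMode Y u n vacuum = 0
  /-- the constant term of `Y(u,z)𝟏` is `u` -/
  creation : ∀ u : V, vertexMode Y u (-1) vacuum = u
  /-- The Jacobi identity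
  `z₀⁻¹δ((z₁-z₂)/z₀) Y(u,z₁)Y(v,z₂)w - z₀⁻¹δ((z₂-z₁)/(-z₀)) Y(v,z₂)Y(u,z₁)w
    = z₂⁻¹δ((z₁-z₀)/z₂) Y(Y(u,z₀)v,z₂)w`, written out as the equality of the coefficients of
  `z₀^{-l-1} z₁^{-m-1} z₂^{-n-1}` on both sides.  All three sums have finitely many
  nonzero terms. -/
  jacobi : ∀ (u v w : V) (l m n : ℤ),
    (∑ᶠ i : ℕ, ((-1 : ℤ) ^ i * Ring.choose l i) •
        vertexMode Y u (m + l - i) (vertexMode Y v (n + i) w)) -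
      (Int.negOnePow l : ℤ) • (∑ᶠ i : ℕ, ((-1 : ℤ) ^ i * Ring.choose l i) •
        vertexMode Y v (n + l - i) (vertexMode Y u (m + i) w)) =
    ∑ᶠ i : ℕ, (Ring.choose m i) •
        vertexMode Y (vertexMode Y u (l + i) v) (m + n - i) w
  /-- The Virasoro relations for `L(n) = ω_{n+1}` -/
  virasoro : ∀ (m n : ℤ) (v : V),
    vertexMode Y omega (m + 1) (vertexMode Y omega (n + 1) v) -
      vertexMode Y omega (n + 1) (vertexMode Y omega (m + 1) v) =
    ((m : ℂ) - n) • vertexMode Y omega (m + n + 1) v +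
      (if m + n = 0 then (((m : ℂ) ^ 3 - m) / 12 * centralCharge) • v else 0)
  /-- `L(0) v = n v` for `v ∈ V_n` -/
  L_zero : ∀ (n : ℤ) (v : V), v ∈ wt n → vertexMode Y omega 1 v = (n : ℂ) • v
  /-- `Y(L(-1)u,z) = d/dz Y(u,z)` -/
  L_neg_one : ∀ (u : V) (n : ℤ),
    vertexMode Y (vertexMode Y omega 0 u) n = (-(n : ℂ)) • vertexMode Y u (n - 1)

namespace VertexOperatorAlgebra

variable {V : Type*} [AddCommGroup V] [Module ℂ V] (A : VertexOperatorAlgebra V)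

/-- The mode `u_n` of `Y(u,z) = ∑_n u_n z^{-n-1}`. -/
abbrev mode (u : V) (n : ℤ) : Module.End ℂ V := vertexMode A.Y u n

/-- The Virasoro operator `L(n) = ω_{n+1}`. -/
def L (n : ℤ) : Module.End ℂ V := A.mode A.omega (n + 1)

/-- The automorphism group of `V`: the linear automorphisms `g` with
`g Y(u,z) v = Y(g u,z) g v`, `g 𝟏 = 𝟏` and `g ω = ω`. -/
def Aut : Subgroup (V ≃ₗ[ℂ] V) where
  carrier := {g | (∀ (u v : V) (n : ℤ), g (A.mode u n v) = A.mode (g u) n (g v)) ∧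
    g A.vacuum = A.vacuum ∧ g A.omega = A.omega}
  mul_mem' := by
    rintro a b ⟨ha, ha1, ha2⟩ ⟨hb, hb1, hb2⟩
    refine ⟨fun u v n => ?_, ?_, ?_⟩
    · simp only [LinearEquiv.mul_apply, hb, ha]
    · simp only [LinearEquiv.mul_apply, hb1, ha1]
    · simp only [LinearEquiv.mul_apply, hb2, ha2]
  one_mem' := ⟨fun _ _ _ => rfl, rfl, rfl⟩
  inv_mem' := by
    rintro a ⟨ha, ha1, ha2⟩
    have key : ∀ x, a (a⁻¹ x) = x := fun x => a.apply_symm_apply x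
    refine ⟨fun u v n => ?_, ?_, ?_⟩
    · apply a.injective
      rw [ha, key, key, key]
    · apply a.injective
      rw [key, ha1]
    · apply a.injective
      rw [key, ha2]

theorem mode_add (u u' : V) (n : ℤ) : A.mode (u + u') n = A.mode u n + A.mode u' n := by
  simp only [mode, vertexMode, map_add, Pi.add_apply]

theorem mode_smul (c : ℂ) (u : V) (n : ℤ) : A.mode (c • u) n = c • A.mode u n := by
  simp only [mode, vertexMode, map_smul, Pi.smul_apply]

theorem mode_eventually_zero (u v : V) : ∃ N : ℤ, ∀ n, N ≤ n → A.mode u n v = 0 :=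
  ⟨-((HahnModule.of ℂ).symm (A.Y u v)).order, fun n hn =>
    VertexOperator.ncoeff_eq_zero_of_lt_order (A.Y u) n v (by lia)⟩

theorem residue_finite (α : ℂ) (k : ℤ) (u v : V) :
    (Function.support fun i : ℕ => Ring.choose α i • A.mode u (k + i) v).Finite := by
  obtain ⟨N, hN⟩ := A.mode_eventually_zero u v
  refine (Set.finite_Iio (N - k).toNat).subset fun i hi => ?_
  by_contra h
  apply hi
  simp only [Set.mem_Iio, not_lt] at h
  simp only [hN (k + i) (by lia), smul_zero]

/-- `Res_z (1+z)^α z^k Y(u,z)v = ∑_{i ≥ 0} (α choose i) u_{k+i} v`, where `(1+z)^α` is expanded in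
nonnegative powers of `z`; a finite sum, bilinear in `u` and `v`. -/
def residue (α : ℂ) (k : ℤ) : V →ₗ[ℂ] V →ₗ[ℂ] V :=
  LinearMap.mk₂ ℂ (fun u v => ∑ᶠ i : ℕ, Ring.choose α i • A.mode u (k + i) v)
    (fun u u' v => by
      rw [← finsum_add_distrib (A.residue_finite α k u v) (A.residue_finite α k u' v)]
      exact finsum_congr fun i => by rw [mode_add, LinearMap.add_apply, smul_add])
    (fun c u v => by
      rw [smul_finsum]
      exact finsum_congr fun i => by rw [mode_smul, LinearMap.smul_apply, smul_comm])
    (fun u v v' => by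
      rw [← finsum_add_distrib (A.residue_finite α k u v) (A.residue_finite α k u v')]
      simp)
    (fun c u v => by
      rw [smul_finsum]
      exact finsum_congr fun i => by simp [smul_comm c])

theorem residue_apply (α : ℂ) (k : ℤ) (u v : V) :
    A.residue α k u v = ∑ᶠ i : ℕ, Ring.choose α i • A.mode u (k + i) v := rfl

theorem bijective_coeLinearMap : Function.Bijective (DirectSum.coeLinearMap A.wt) :=
  A.isInternal

/-- The linear map on `V = ⨁ V_n` which agrees with `f n` on `V_n`. -/
def extendByWeight {W : Type*} [AddCommGroup W] [Module ℂ W] (f : ℤ → V →ₗ[ℂ] W) : V →ₗ[ℂ] W :=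
  DirectSum.toModule ℂ ℤ W (fun n => f n ∘ₗ (A.wt n).subtype) ∘ₗ
    (LinearEquiv.ofBijective (DirectSum.coeLinearMap A.wt) A.bijective_coeLinearMap).symm.toLinearMap

theorem extendByWeight_apply {W : Type*} [AddCommGroup W] [Module ℂ W] (f : ℤ → V →ₗ[ℂ] W)
    {n : ℤ} {v : V} (hv : v ∈ A.wt n) : A.extendByWeight f v = f n v := by
  have h : (LinearEquiv.ofBijective (DirectSum.coeLinearMap A.wt) A.bijective_coeLinearMap).symm v =
      DirectSum.lof ℂ ℤ (fun n => A.wt n) n ⟨v, hv⟩ := by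
    rw [LinearEquiv.symm_apply_eq]
    simp
  simp [extendByWeight, h]

/-- The eigenspace `V^r = {v | g v = e^{2πir/T} v}`, where `T` is the order of `g`. -/
def eigen (g : A.Aut) (r : ℕ) : Submodule ℂ V :=
  Module.End.eigenspace (g.1 : V →ₗ[ℂ] V)
    (Complex.exp (2 * Real.pi * Complex.I * r / orderOf g))

/-- `u ∘_g v = Res_z (1+z)^{n-1+δ_r+r/T} z^{-1-δ_r} Y(u,z)v` for `u ∈ V^r` of weight `n`
(`0 ≤ r < T`), where `δ_r` is `1` if `r = 0` and `0` otherwise. -/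
def circ (g : A.Aut) (n : ℤ) (r : ℕ) (u v : V) : V :=
  A.residue (n - 1 + (if r = 0 then 1 else 0) + r / orderOf g) (-1 - (if r = 0 then 1 else 0)) u v

/-- `O_g(V)`: the linear span of all `u ∘_g v`, with `u ∈ V^r` homogeneous and `v ∈ V`. -/
def Og (g : A.Aut) : Submodule ℂ V :=
  Submodule.span ℂ {x | ∃ (n : ℤ) (r : ℕ) (u v : V),
    r < orderOf g ∧ u ∈ A.wt n ∧ u ∈ A.eigen g r ∧ x = A.circ g n r u v}

/-- The quotient space `A_g(V) = V / O_g(V)`. -/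
abbrev Ag (g : A.Aut) : Type _ := V ⧸ A.Og g

/-- The projection of `V = ⨁_r V^r` onto the fixed space `V^0`, obtained by averaging over the
cyclic group generated by `g`. -/
def projFixed (g : A.Aut) : V →ₗ[ℂ] V :=
  (orderOf g : ℂ)⁻¹ • ∑ k ∈ Finset.range (orderOf g), ((g.1 ^ k : V ≃ₗ[ℂ] V) : V →ₗ[ℂ] V)

/-- The bilinear product `*_g` on `V`: for `u ∈ V^r` of weight `n` it is given by
`u *_g v = Res_z (1+z)^n z^{-1} Y(u,z)v` if `r = 0` and `u *_g v = 0` if `0 < r < T`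
(see `star_apply_zero` and `star_apply_pos`), and it is extended linearly in `u`. -/
def star (g : A.Aut) : V →ₗ[ℂ] V →ₗ[ℂ] V :=
  A.extendByWeight (fun n => A.residue n (-1)) ∘ₗ A.projFixed g

theorem pow_apply_of_mem_eigen (g : A.Aut) {r : ℕ} {u : V} (hu : u ∈ A.eigen g r) (k : ℕ) :
    (g.1 ^ k : V ≃ₗ[ℂ] V) u =
      (Complex.exp (2 * Real.pi * Complex.I * r / orderOf g)) ^ k • u := by
  induction k with
  | zero => simp
  | succ k ih =>
    have h : g.1 u = Complex.exp (2 * Real.pi * Complex.I * r / orderOf g) • u :=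
      Module.End.mem_eigenspace_iff.1 hu
    rw [pow_succ, LinearEquiv.mul_apply, h, map_smul, ih, smul_smul, pow_succ, mul_comm]

theorem star_apply_zero (g : A.Aut) (hg : IsOfFinOrder g) {n : ℤ} {u : V} (hn : u ∈ A.wt n)
    (hu : u ∈ A.eigen g 0) (v : V) :
    A.star g u v = ∑ᶠ i : ℕ, Ring.choose (n : ℂ) i • A.mode u (-1 + i) v := by
  have hT : (orderOf g : ℂ) ≠ 0 := by exact_mod_cast hg.orderOf_pos.ne'
  have h : A.projFixed g u = u := by
    simp only [projFixed, LinearMap.smul_apply, LinearMap.sum_apply, LinearEquiv.coe_coe,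
      A.pow_apply_of_mem_eigen g hu]
    simp [← Nat.cast_smul_eq_nsmul ℂ, smul_smul, hT]
  rw [star, LinearMap.comp_apply, h, A.extendByWeight_apply _ hn, residue_apply]

theorem star_apply_pos (g : A.Aut) {r : ℕ} (h0 : 0 < r) (hr : r < orderOf g)
    {u : V} (hu : u ∈ A.eigen g r) (v : V) : A.star g u v = 0 := by
  have hprim := (Complex.isPrimitiveRoot_exp (orderOf g) (by lia)).pow_eq_one
  have hT : (orderOf g : ℂ) ≠ 0 := by
    have : orderOf g ≠ 0 := by lia
    exact_mod_cast this
  have hz : Complex.exp (2 * Real.pi * Complex.I * r / orderOf g) =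
      Complex.exp (2 * Real.pi * Complex.I / orderOf g) ^ r := by
    rw [← Complex.exp_nat_mul]
    congr 1
    ring
  have hne : Complex.exp (2 * Real.pi * Complex.I * r / orderOf g) ≠ 1 := by
    rw [hz]
    exact (Complex.isPrimitiveRoot_exp (orderOf g) (by lia)).pow_ne_one_of_pos_of_lt h0.ne' hr
  have h : A.projFixed g u = 0 := by
    simp only [projFixed, LinearMap.smul_apply, LinearMap.sum_apply, LinearEquiv.coe_coe,
      A.pow_apply_of_mem_eigen g hu]
    rw [← Finset.sum_smul, geom_sum_eq hne, hz, ← pow_mul, mul_comm r, pow_mul, hprim]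
    simp
  rw [star, LinearMap.comp_apply, h]
  simp

/-- A homogeneous space is the whole eigenspace of `L(0)`. -/
theorem mem_wt_of_L_zero {n : ℤ} {v : V} (h : A.L 0 v = (n : ℂ) • v) : v ∈ A.wt n := by
  classical
  let _ := A.isInternal.chooseDecomposition
  have hsum := DirectSum.sum_support_decompose A.wt v
  have hL : ∀ m : ℤ, (DirectSum.decompose A.wt (A.L 0 v) m : V) =
      (m : ℂ) • (DirectSum.decompose A.wt v m : V) := by
    intro m
    have key : ∀ x : V, (DirectSum.decompose A.wt (A.L 0 x) m : V) =
      (m : ℂ) • (DirectSum.decompose A.wt x m : V) := by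
      intro x
      induction x using DirectSum.Decomposition.inductionOn A.wt with
      | zero => simp
      | @homogeneous i a =>
        have ha : A.L 0 (a : V) = (i : ℂ) • (a : V) := A.L_zero i a a.2
        rw [ha, DirectSum.decompose_smul, DirectSum.smul_apply, Submodule.coe_smul]
        by_cases him : i = m
        · subst him
          rfl
        · rw [DirectSum.decompose_of_mem_ne A.wt a.2 him]
          simp
      | add a b ha hb =>
        simp only [map_add, DirectSum.decompose_add, DirectSum.add_apply, Submodule.coe_add,
          ha, hb, smul_add]
    exact key v
  have hz : ∀ m : ℤ, m ≠ n → (DirectSum.decompose A.wt v m : V) = 0 := by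
    intro m hm
    have h1 := hL m
    rw [h, DirectSum.decompose_smul, DirectSum.smul_apply, Submodule.coe_smul, ← sub_eq_zero,
      ← sub_smul, smul_eq_zero, sub_eq_zero] at h1
    rcases h1 with h1 | h1
    · exact absurd (by exact_mod_cast h1.symm) hm
    · exact h1
  rw [← hsum]
  refine Submodule.sum_mem _ fun i _ => ?_
  by_cases hi : i = n
  · rw [← hi]
    exact (DirectSum.decompose A.wt v i).2
  · rw [hz i hi]
    exact Submodule.zero_mem _

theorem L_one_pow_mem {n : ℤ} {v : V} (hv : v ∈ A.wt n) (j : ℕ) :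
    (A.L 1 ^ j) v ∈ A.wt (n - j) := by
  induction j with
  | zero => simpa using hv
  | succ j ih =>
    rw [pow_succ', Module.End.mul_apply]
    set x := (A.L 1 ^ j) v
    apply A.mem_wt_of_L_zero
    have h1 := A.virasoro 0 1 x
    have h0 : vertexMode A.Y A.omega (0 + 1) x = ((n - j : ℤ) : ℂ) • x := A.L_zero _ x ih
    rw [h0, map_smul, sub_eq_iff_eq_add] at h1
    change A.L 0 (A.L 1 x) = _ at h1
    rw [h1]
    change ((0 : ℤ) - (1 : ℤ) : ℂ) • A.L 1 x + _ + _ • A.L 1 x = _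
    rw [if_neg (by lia), add_zero, ← add_smul]
    congr 1
    push_cast
    ring

/-- `L(1)` is locally nilpotent. -/
theorem L_one_locally_nilpotent (v : V) : ∃ N : ℕ, ∀ j, N ≤ j → (A.L 1 ^ j) v = 0 := by
  have hv : v ∈ ⨆ n, A.wt n := by
    rw [A.isInternal.submodule_iSup_eq_top]
    trivial
  obtain ⟨M, hM⟩ := A.bounded_below
  induction hv using Submodule.iSup_induction' with
  | mem n x hx =>
    refine ⟨(n - M + 1).toNat, fun j hj => ?_⟩
    have := A.L_one_pow_mem hx j
    rw [hM _ (by lia)] at this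
    simpa using this
  | zero => exact ⟨0, fun j _ => map_zero _⟩
  | add x y _ _ hx hy =>
    obtain ⟨N, hN⟩ := hx
    obtain ⟨N', hN'⟩ := hy
    refine ⟨max N N', fun j hj => ?_⟩
    rw [map_add, hN j (by lia), hN' j (by lia), add_zero]

theorem exp_finite (v : V) :
    (Function.support fun j : ℕ => ((j.factorial : ℂ)⁻¹) • (A.L 1 ^ j) v).Finite := by
  obtain ⟨N, hN⟩ := A.L_one_locally_nilpotent v
  refine (Set.finite_Iio N).subset fun j hj => ?_
  by_contra h
  apply hj
  simp only [Set.mem_Iio, not_lt] at h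
  simp only [hN j h, smul_zero]

/-- `e^{L(1)} = ∑_j L(1)^j / j!`, a finite sum on each vector. -/
def expL : Module.End ℂ V where
  toFun v := ∑ᶠ j : ℕ, ((j.factorial : ℂ)⁻¹) • (A.L 1 ^ j) v
  map_add' v w := by
    rw [← finsum_add_distrib (A.exp_finite v) (A.exp_finite w)]
    simp
  map_smul' c v := by
    rw [RingHom.id_apply, smul_finsum]
    exact finsum_congr fun j => by rw [map_smul, smul_comm]

/-- `(-1)^{L(0)}`: multiplication by `(-1)^n` on `V_n`. -/
def signL : Module.End ℂ V :=
  A.extendByWeight fun n => ((-1 : ℂ) ^ n) • LinearMap.id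

/-- The linear map `φ(a) = e^{L(1)} (-1)^{L(0)} a` on `V`. -/
def phi : Module.End ℂ V := A.expL ∘ₗ A.signL

end VertexOperatorAlgebra

end

/-!
Residues against `Y(u, z)` are taken with arbitrary Laurent series in place of monomials: both sides
of the Borcherds identity are bilinear and continuous in the two series, so the identity extends
from monomials. With the series `(1 + z)^α z^k` it gives commutator and iterate formulas for the
residues in `∘_g` and `*_g`. The translation property `Y(L(-1)u, z) = d/dz Y(u, z)` shows that the
residues defining `u ∘_g v` stay in `O_g(V)` when the pole order is raised, which makes `O_g(V)` an
ideal for `*_g` and makes all correction terms to associativity and commutativity vanish. If `r ≠ 0`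
then `V^r ⊆ O_g(V)`, so only `g`-fixed vectors matter in `A_g(V)`.

Expanding the conjugation by `e^{L(1)}` with the Leibniz rule for `ad L(1)`, the map `φ` turns the
residue of `(1 + z)^α z^m Y(a, z) b` into residues of `(1 + z)^{2 wt a - m - 2 - j - α} z^m` against
`Y(L(1)^j a, z) φ(b)`. This exchanges `r/T` with `1 - r/T`, so `φ` maps `O_g(V)` into
`O_{g⁻¹}(V)`; it is bijective because `φ² = 1`.
-/

noncomputable section

open Finset.HasAntidiagonal (antidiagonal mem_antidiagonal)

/-! ### Finite sums and binomial coefficients -/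

theorem finsum_mem_of_forall_mem {R M ι : Type*} [Semiring R] [AddCommMonoid M] [Module R M]
    (S : Submodule R M) {f : ι → M} (h : ∀ i, f i ∈ S) : ∑ᶠ i, f i ∈ S :=
  finsum_induction (· ∈ S) S.zero_mem (fun _ _ => S.add_mem) h

theorem finsum_eq_sum_range {M : Type*} [AddCommMonoid M] {f : ℕ → M} {N : ℕ}
    (h : ∀ i, N ≤ i → f i = 0) : ∑ᶠ i, f i = ∑ i ∈ Finset.range N, f i :=
  finsum_eq_sum_of_support_subset f fun i hi => by
    rw [Finset.coe_range, Set.mem_Iio]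
    exact not_le.1 fun hN => hi (h i hN)

theorem finsum_smodEq_apply_zero {R M : Type*} [Ring R] [AddCommGroup M] [Module R M]
    (S : Submodule R M) {f : ℕ → M} (hf : f.support.Finite) (h : ∀ i, f (i + 1) ∈ S) :
    ∑ᶠ i, f i ≡ f 0 [SMOD S] := by
  rw [SModEq.def, ← Submodule.mkQ_apply, ← Submodule.mkQ_apply, map_finsum _ hf]
  refine finsum_eq_single _ 0 fun i hi => ?_
  obtain ⟨i, rfl⟩ := Nat.exists_eq_succ_of_ne_zero hi
  exact (Submodule.Quotient.mk_eq_zero S).2 (h i)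

theorem finsum_finsum_eq_finsum_antidiagonal {M : Type*} [AddCommMonoid M] {f : ℕ → ℕ → M} {N : ℕ}
    (h : ∀ i j, N ≤ i + j → f i j = 0) :
    ∑ᶠ i, ∑ᶠ j, f i j = ∑ᶠ n, ∑ q ∈ antidiagonal n, f q.1 q.2 := by
  let s := Finset.range N ×ˢ Finset.range N
  have hs : ∀ q ∉ s, f q.1 q.2 = 0 := fun q hq => h _ _ <| by
    simp only [s, Finset.mem_product, Finset.mem_range] at hq
    lia
  have support_subset : (fun q : ℕ × ℕ => f q.1 q.2).support ⊆ s :=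
    fun q hq => by_contra fun hqs => hq (hs q hqs)
  rw [← finsum_curry (fun q : ℕ × ℕ => f q.1 q.2) (s.finite_toSet.subset support_subset),
    finsum_eq_sum_of_support_subset _ support_subset,
    ← finsum_sum_filter (fun q : ℕ × ℕ => q.1 + q.2)]
  refine finsum_congr fun n => Finset.sum_subset (fun q hq => ?_) fun q hq hqs => hs q ?_
  · exact mem_antidiagonal.2 (Finset.mem_filter.1 hq).2
  · rwa [Finset.mem_filter, and_iff_left (mem_antidiagonal.1 hq)] at hqs

theorem sum_antidiagonal_succ_add {M : Type*} [AddCommMonoid M] {u v : ℕ → ℕ → M}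
    (hu : ∀ j, u 0 j = 0) (hv : ∀ k, v k 0 = 0) (N : ℕ) :
    ∑ q ∈ antidiagonal (N + 1), (u q.1 q.2 + v q.1 q.2) =
      ∑ q ∈ antidiagonal N, (u (q.1 + 1) q.2 + v q.1 (q.2 + 1)) := by
  rw [Finset.sum_add_distrib, Finset.sum_add_distrib,
    Finset.Nat.sum_antidiagonal_succ (f := fun q => u q.1 q.2), hu, zero_add,
    Finset.Nat.sum_antidiagonal_succ' (f := fun q => v q.1 q.2), hv, zero_add]

theorem iSup_eigenspace_eq_top_of_pow_eq_one {K M : Type*} [Field K] [IsAlgClosed K]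
    [AddCommGroup M] [Module K M] [FiniteDimensional K M] {f : Module.End K M} {T : ℕ}
    (hT : (T : K) ≠ 0) (hf : f ^ T = 1) : ⨆ μ, f.eigenspace μ = ⊤ :=
  (Module.End.isSemisimple_of_squarefree_aeval_eq_zero
    (Polynomial.X_pow_sub_one_separable_iff.2 hT).squarefree
    (by simp [hf])).iSup_eigenspace_eq_top

theorem neg_one_zpow_sub_natCast (n : ℤ) (j : ℕ) :
    (-1 : ℂ) ^ (n - j) = (-1) ^ n * (-1) ^ j := by
  rw [zpow_sub₀ (neg_ne_zero.2 one_ne_zero), div_eq_mul_inv, zpow_natCast, ← inv_pow, inv_neg,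
    inv_one]

section Choose

variable {R : Type*} [CommRing R] [BinomialRing R]

theorem intCast_choose (R : Type*) [CommRing R] [BinomialRing R] (n : ℤ) (k : ℕ) :
    ((Ring.choose n k : ℤ) : R) = Ring.choose (n : R) k :=
  Ring.map_choose (Int.castRingHom R) n k

theorem choose_mul_choose_sub {R : Type*} [CommRing R] [BinomialRing R] (α : R) {q t : ℕ}
    (h : q ≤ t) :
    Ring.choose α q * Ring.choose (α - q) (t - q) = t.choose q * Ring.choose α t := by
  have := Ring.choose_add_smul_choose (α - q) (t - q) q
  rw [sub_add_cancel, Nat.sub_add_cancel h, nsmul_eq_mul] at this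
  exact this.symm

theorem succ_mul_choose_succ (α : R) (k : ℕ) :
    (k + 1 : R) * Ring.choose α (k + 1) = α * Ring.choose (α - 1) k := by
  simpa using Ring.choose_add_smul_choose (α - 1) k 1

theorem add_mul_choose_sub_mul_choose {R : Type*} [CommRing R] [BinomialRing R] (α t : R) (k : ℕ) :
    (t + k + 1) * Ring.choose α (k + 1) - t * Ring.choose (α - 1) (k + 1) =
      (α + t) * Ring.choose (α - 1) k := by
  have pascal := Ring.choose_succ_succ (α - 1) k
  rw [sub_add_cancel] at pascal
  linear_combination t * pascal + succ_mul_choose_succ α k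

theorem neg_one_pow_mul_choose (α : R) (k : ℕ) :
    (-1 : R) ^ k * Ring.choose α k = Ring.choose (k - 1 - α) k := by
  have h := Ring.choose_neg (-α) k
  rw [neg_neg, Units.smul_def, Int.negOnePow_def, zpow_natCast, Units.val_pow_eq_pow_val,
    zsmul_eq_mul, Units.val_neg, Units.val_one, Int.cast_pow, Int.cast_neg, Int.cast_one] at h
  rw [h, ← mul_assoc, ← mul_pow, neg_one_mul, neg_neg, one_pow, one_mul, neg_add_eq_sub,
    sub_right_comm]

theorem sum_antidiagonal_neg_one_pow_choose (α β : R) (s : ℕ) :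
    ∑ q ∈ antidiagonal s, (-1 : R) ^ q.1 * Ring.choose α q.1 * Ring.choose (β - q.1) q.2 =
      Ring.choose (β - α) s := by
  have sign_mul_sign (k : ℕ) : (-1 : R) ^ k * (-1) ^ k = 1 := by
    rw [← mul_pow, neg_one_mul, neg_neg, one_pow]
  -- Reflecting the upper indices reduces the identity to Vandermonde's.
  have reflect : ∀ q ∈ antidiagonal s, (-1 : R) ^ q.1 * Ring.choose α q.1 *
      Ring.choose (β - q.1) q.2 = (-1) ^ s * (Ring.choose α q.1 * Ring.choose (s - 1 - β) q.2) := by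
    rintro ⟨i, j⟩ hij
    obtain rfl := mem_antidiagonal.1 hij
    rw [show ((i + j : ℕ) - 1 - β : R) = j - 1 - (β - i) by push_cast; ring,
      ← neg_one_pow_mul_choose, pow_add]
    linear_combination (-(-1) ^ i * Ring.choose α i * Ring.choose (β - i) j) * sign_mul_sign j
  rw [Finset.sum_congr rfl reflect, ← Finset.mul_sum, ← Ring.add_choose_eq s (Commute.all _ _),
    show α + (s - 1 - β) = s - 1 - (β - α) by ring, ← neg_one_pow_mul_choose, ← mul_assoc,
    sign_mul_sign, one_mul]

end Choose

section InverseFactorial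

variable {K M : Type*} [Field K] [CharZero K] [AddCommGroup M] [Module K M]

theorem sum_antidiagonal_neg_one_pow_inv_factorial {K : Type*} [Field K] [CharZero K] (N : ℕ) :
    ∑ q ∈ antidiagonal N, (-1) ^ q.1 * (q.1.factorial : K)⁻¹ * (q.2.factorial : K)⁻¹ =
      if N = 0 then 1 else 0 := by
  have h := congrArg (PowerSeries.coeff N) (PowerSeries.exp_mul_exp_neg_eq_one (A := K))
  rw [mul_comm] at h
  simpa [PowerSeries.coeff_mul, PowerSeries.evalNegHom, PowerSeries.coeff_rescale,
    PowerSeries.coeff_exp, PowerSeries.coeff_one] using h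

theorem succ_smul_sum_antidiagonal {K M : Type*} [Field K] [CharZero K] [AddCommGroup M]
    [Module K M] (x : K) (X : ℕ → ℕ → M) (N : ℕ) :
    (N + 1 : K) • ∑ q ∈ antidiagonal (N + 1),
        ((q.1.factorial : K)⁻¹ * Ring.choose (x - q.1) q.2) • X q.1 q.2 =
      ∑ q ∈ antidiagonal N,
          ((q.1.factorial : K)⁻¹ * Ring.choose (x - 2 - q.1) q.2) • X (q.1 + 1) q.2 +
        x • ∑ q ∈ antidiagonal N,
          ((q.1.factorial : K)⁻¹ * Ring.choose (x - 1 - q.1) q.2) • X q.1 (q.2 + 1) := by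
  let u (j k : ℕ) := ((j.factorial : K)⁻¹ * (j * Ring.choose (x - j - 1) k)) • X j k
  let v (j k : ℕ) := ((j.factorial : K)⁻¹ *
    ((j + k) * Ring.choose (x - j) k - j * Ring.choose (x - j - 1) k)) • X j k
  have hu (k : ℕ) : u 0 k = 0 := by
    simp only [u, Nat.cast_zero, zero_mul, mul_zero, zero_smul]
  have hv (j : ℕ) : v j 0 = 0 := by
    simp only [v, Ring.choose_zero_right, Nat.cast_zero, add_zero, sub_self, mul_zero, zero_smul]
  have hu_succ (j k : ℕ) :
      u (j + 1) k = ((j.factorial : K)⁻¹ * Ring.choose (x - 2 - j) k) • X (j + 1) k := by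
    have hj : (j + 1 : K) ≠ 0 := j.cast_add_one_ne_zero
    simp only [u]
    rw [Nat.factorial_succ, Nat.cast_mul, mul_inv_rev, mul_assoc, Nat.cast_succ,
      inv_mul_cancel_left₀ hj, show x - (j + 1) - 1 = x - 2 - j by ring]
  have hv_succ (j k : ℕ) :
      v j (k + 1) = x • ((j.factorial : K)⁻¹ * Ring.choose (x - 1 - j) k) • X j (k + 1) := by
    simp only [v]
    rw [Nat.cast_succ, ← add_assoc, add_mul_choose_sub_mul_choose, sub_add_cancel, smul_smul,
      mul_left_comm, sub_right_comm]
  rw [Finset.smul_sum, Finset.smul_sum, ← Finset.sum_add_distrib]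
  simp only [← hu_succ, ← hv_succ]
  rw [← sum_antidiagonal_succ_add hu hv]
  refine Finset.sum_congr rfl fun q hq => ?_
  have hq : (q.1 + q.2 : K) = N + 1 := by exact_mod_cast mem_antidiagonal.1 hq
  rw [← add_smul, smul_smul, ← hq]
  ring_nf

attribute [local instance] LieRing.ofAssociativeRing in
theorem inv_factorial_smul_pow_apply {K M : Type*} [Field K] [CharZero K] [AddCommGroup M]
    [Module K M] (D X : Module.End K M) (w : M) (N : ℕ) :
    (N.factorial : K)⁻¹ • (D ^ N) (X w) = ∑ q ∈ antidiagonal N,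
      ((q.1.factorial : K)⁻¹ • (LieAlgebra.ad K (Module.End K M) D ^ q.1) X)
        ((q.2.factorial : K)⁻¹ • (D ^ q.2) w) := by
  have leibniz : (D ^ N) (X w) = ∑ q ∈ antidiagonal N,
      N.choose q.1 • ((LieAlgebra.ad K (Module.End K M) D ^ q.1) X) ((D ^ q.2) w) :=
    LieModule.toEnd_pow_lie (R := K) D X w N
  rw [leibniz, Finset.smul_sum]
  refine Finset.sum_congr rfl fun q hq => ?_
  have hN : (N.factorial : K) ≠ 0 := Nat.cast_ne_zero.2 N.factorial_ne_zero
  rw [LinearMap.smul_apply, map_smul, smul_smul, ← Nat.cast_smul_eq_nsmul K, smul_smul,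
    ← mem_antidiagonal.1 hq, Nat.cast_add_choose, mem_antidiagonal.1 hq, ← mul_inv,
    ← mul_div_assoc, inv_mul_cancel₀ hN, one_div]

end InverseFactorial

/-! ### Linear functionals on Laurent series -/

section LaurentSeriesFunctionals

open LaurentSeries HahnSeries

variable {R W : Type*} [CommRing R] [AddCommGroup W] [Module R W]

theorem order_le_orderTop (F : R⸨X⸩) : (F.order : WithTop ℤ) ≤ F.orderTop :=
  le_orderTop_iff_forall.2 fun _ hj => coeff_eq_zero_of_lt_order (WithTop.coe_lt_coe.1 hj)

theorem le_orderTop_single_mul (j : ℤ) (F : R⸨X⸩) :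
    ((j + F.order : ℤ) : WithTop ℤ) ≤ (single j 1 * F).orderTop := by
  rw [WithTop.coe_add]
  exact (add_le_add orderTop_single_le (order_le_orderTop F)).trans orderTop_add_le_mul

theorem le_orderTop_sub_sum_single (F : R⸨X⸩) (K : ℤ) :
    (K : WithTop ℤ) ≤ (F - ∑ n ∈ Finset.Ico F.order K, single n (F.coeff n)).orderTop := by
  refine le_orderTop_iff_forall.2 fun j hj => ?_
  rw [WithTop.coe_lt_coe] at hj
  rw [coeff_sub, coeff_sum, Finset.sum_eq_single j (fun n _ hn => coeff_single_of_ne hn.symm),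
    coeff_single_same, sub_self]
  intro h
  rw [coeff_single_same]
  exact coeff_eq_zero_of_lt_order (by simpa [hj] using h)

theorem laurent_mul_smul (r : R) (F G : R⸨X⸩) : F * (r • G) = r • (F * G) := by
  rw [← single_zero_mul_eq_smul, ← single_zero_mul_eq_smul, mul_left_comm]

/-- Multiplication of Laurent series as an `R`-bilinear map. -/
def laurentMul (R : Type*) [CommRing R] : R⸨X⸩ →ₗ[R] R⸨X⸩ →ₗ[R] R⸨X⸩ :=
  LinearMap.mk₂ R (· * ·) add_mul
    (fun r F G => by rw [mul_comm, laurent_mul_smul, mul_comm]) mul_add laurent_mul_smul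

/-- Continuity of a linear map on Laurent series for the `X`-adic topology on the source and the
discrete topology on the target. -/
def VanishesAtHighOrder (T : R⸨X⸩ →ₗ[R] W) : Prop :=
  ∃ K : ℤ, ∀ F : R⸨X⸩, (K : WithTop ℤ) ≤ F.orderTop → T F = 0

theorem VanishesAtHighOrder.add {T T' : R⸨X⸩ →ₗ[R] W} (hT : VanishesAtHighOrder T)
    (hT' : VanishesAtHighOrder T') : VanishesAtHighOrder (T + T') := by
  obtain ⟨K, hK⟩ := hT
  obtain ⟨K', hK'⟩ := hT'
  refine ⟨max K K', fun F hF => ?_⟩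
  rw [WithTop.coe_max, max_le_iff] at hF
  rw [LinearMap.add_apply, hK F hF.1, hK' F hF.2, add_zero]

theorem VanishesAtHighOrder.sub {T T' : R⸨X⸩ →ₗ[R] W} (hT : VanishesAtHighOrder T)
    (hT' : VanishesAtHighOrder T') : VanishesAtHighOrder (T - T') := by
  obtain ⟨K, hK⟩ := hT
  obtain ⟨K', hK'⟩ := hT'
  refine ⟨max K K', fun F hF => ?_⟩
  rw [WithTop.coe_max, max_le_iff] at hF
  rw [LinearMap.sub_apply, hK F hF.1, hK' F hF.2, sub_zero]

theorem VanishesAtHighOrder.smul {T : R⸨X⸩ →ₗ[R] W} (hT : VanishesAtHighOrder T) (r : R) :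
    VanishesAtHighOrder (r • T) := by
  obtain ⟨K, hK⟩ := hT
  exact ⟨K, fun F hF => by rw [LinearMap.smul_apply, hK F hF, smul_zero]⟩

theorem VanishesAtHighOrder.sum {ι : Type*} (s : Finset ι) {T : ι → R⸨X⸩ →ₗ[R] W}
    (hT : ∀ i ∈ s, VanishesAtHighOrder (T i)) : VanishesAtHighOrder (∑ i ∈ s, T i) := by
  induction s using Finset.cons_induction with
  | empty => exact ⟨0, fun F _ => by rw [Finset.sum_empty, LinearMap.zero_apply]⟩
  | cons i s hi ih =>
    rw [Finset.sum_cons]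
    exact (hT i (Finset.mem_cons_self i s)).add (ih fun j hj => hT j (Finset.mem_cons_of_mem hj))

theorem VanishesAtHighOrder.ext {T T' : R⸨X⸩ →ₗ[R] W} (hT : VanishesAtHighOrder T)
    (hT' : VanishesAtHighOrder T') (h : ∀ n : ℤ, T (single n 1) = T' (single n 1)) : T = T' := by
  rw [← sub_eq_zero]
  ext F
  obtain ⟨K, hK⟩ := hT.sub hT'
  have hF := hK _ (le_orderTop_sub_sum_single F K)
  rw [map_sub, map_sum, sub_eq_zero] at hF
  rw [hF, LinearMap.zero_apply]
  refine Finset.sum_eq_zero fun n _ => ?_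
  have hn : single n (F.coeff n) = F.coeff n • (single n 1 : R⸨X⸩) := by
    rw [← single_zero_mul_eq_smul, single_mul_single, zero_add, mul_one]
  rw [hn, map_smul, LinearMap.sub_apply, h, sub_self, smul_zero]

theorem VanishesAtHighOrder.ext₂ {B B' : R⸨X⸩ →ₗ[R] R⸨X⸩ →ₗ[R] W}
    (hB : ∀ F, VanishesAtHighOrder (B F)) (hB' : ∀ F, VanishesAtHighOrder (B' F))
    (hflip : ∀ G, VanishesAtHighOrder (B.flip G)) (hflip' : ∀ G, VanishesAtHighOrder (B'.flip G))
    (h : ∀ m n : ℤ, B (single m 1) (single n 1) = B' (single m 1) (single n 1)) : B = B' := by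
  refine LinearMap.ext fun F => (hB F).ext (hB' F) fun n => ?_
  exact LinearMap.congr_fun ((hflip (single n 1)).ext (hflip' _) fun m => h m n) F

theorem VanishesAtHighOrder.comp_laurentMul {T : R⸨X⸩ →ₗ[R] W} (hT : VanishesAtHighOrder T)
    (G : R⸨X⸩) : VanishesAtHighOrder (T ∘ₗ laurentMul R G) := by
  obtain ⟨K, hK⟩ := hT
  refine ⟨K - G.order, fun F hF => hK _ ?_⟩
  rw [laurentMul, LinearMap.mk₂_apply, ← add_sub_cancel G.order K, WithTop.coe_add]
  exact (add_le_add (order_le_orderTop G) hF).trans orderTop_add_le_mul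

theorem VanishesAtHighOrder.comp_laurentMul_flip {T : R⸨X⸩ →ₗ[R] W} (hT : VanishesAtHighOrder T)
    (G : R⸨X⸩) : VanishesAtHighOrder (T ∘ₗ (laurentMul R).flip G) := by
  have h : (laurentMul R).flip G = laurentMul R G := LinearMap.ext fun F => mul_comm F G
  exact h ▸ hT.comp_laurentMul G

theorem VanishesAtHighOrder.comp_hasseDeriv {T : R⸨X⸩ →ₗ[R] W} (hT : VanishesAtHighOrder T)
    (s : ℕ) : VanishesAtHighOrder (T ∘ₗ hasseDeriv R s) := by
  obtain ⟨K, hK⟩ := hT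
  refine ⟨K + s, fun F hF => hK _ (le_orderTop_iff_forall.2 fun j hj => ?_)⟩
  rw [WithTop.coe_lt_coe] at hj
  rw [hasseDeriv_coeff, coeff_eq_zero_of_lt_orderTop (lt_of_lt_of_le _ hF), smul_zero]
  exact WithTop.coe_lt_coe.2 (by lia)

theorem coeff_smul_finite {c : ℤ → W} (hc : ∃ N : ℤ, ∀ n, N ≤ n → c n = 0) (F : R⸨X⸩) :
    (Function.support fun n : ℤ => F.coeff n • c n).Finite := by
  obtain ⟨N, hN⟩ := hc
  refine (Set.finite_Ico F.order N).subset fun n hn => ⟨?_, ?_⟩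
  · by_contra h
    exact hn (by simp only [coeff_eq_zero_of_lt_order (not_le.1 h), zero_smul])
  · by_contra h
    exact hn (by simp only [hN n (not_lt.1 h), smul_zero])

/-- The functional `F ↦ Res_z F(z) ∑_n c_n z^{-n-1}` on Laurent series, where `c_n = 0` for `n`
large. -/
def residuePairing (c : ℤ → W) (hc : ∃ N : ℤ, ∀ n, N ≤ n → c n = 0) : R⸨X⸩ →ₗ[R] W where
  toFun F := ∑ᶠ n : ℤ, F.coeff n • c n
  map_add' F G := by
    rw [← finsum_add_distrib (coeff_smul_finite hc F) (coeff_smul_finite hc G)]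
    exact finsum_congr fun n => by rw [coeff_add, add_smul]
  map_smul' r F := by
    rw [RingHom.id_apply, smul_finsum' r (coeff_smul_finite hc F)]
    exact finsum_congr fun n => by rw [coeff_smul, smul_eq_mul, mul_smul]

theorem residuePairing_single {c : ℤ → W} (hc : ∃ N : ℤ, ∀ n, N ≤ n → c n = 0) (n : ℤ) :
    residuePairing c hc (single n (1 : R)) = c n := by
  refine (finsum_eq_single _ n fun m hm => ?_).trans ?_
  · rw [coeff_single_of_ne hm, zero_smul]
  · rw [coeff_single_same, one_smul]

theorem vanishesAtHighOrder_residuePairing {c : ℤ → W} (hc : ∃ N : ℤ, ∀ n, N ≤ n → c n = 0) :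
    VanishesAtHighOrder (residuePairing (R := R) c hc) := by
  obtain ⟨N, hN⟩ := hc
  refine ⟨N, fun F hF => finsum_eq_zero_of_forall_eq_zero fun n => ?_⟩
  rcases lt_or_ge n N with h | h
  · rw [coeff_eq_zero_of_lt_orderTop (lt_of_lt_of_le (WithTop.coe_lt_coe.2 h) hF), zero_smul]
  · rw [hN n h, smul_zero]

theorem residuePairing_mem {c : ℤ → W} (hc : ∃ N : ℤ, ∀ n, N ≤ n → c n = 0) (S : Submodule R W)
    (h : ∀ n, c n ∈ S) (F : R⸨X⸩) : residuePairing c hc F ∈ S :=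
  finsum_mem_of_forall_mem S fun n => S.smul_mem _ (h n)

end LaurentSeriesFunctionals

section BinomialLaurent

open LaurentSeries HahnSeries

/-- The Laurent series `(1 + z)^α z^k`, with `(1 + z)^α` expanded in nonnegative powers of `z`. -/
def binomialLaurent (α : ℂ) (k : ℤ) : ℂ⸨X⸩ :=
  single k 1 * (PowerSeries.binomialSeries ℂ α : ℂ⸨X⸩)

theorem coeff_binomialLaurent_add (α : ℂ) (k : ℤ) (i : ℕ) :
    (binomialLaurent α k).coeff (k + i) = Ring.choose α i := by
  rw [binomialLaurent, add_comm, coeff_single_mul_add, one_mul, coeff_coe_powerSeries,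
    PowerSeries.binomialSeries_coeff, smul_eq_mul, mul_one]

theorem coeff_binomialLaurent_of_lt (α : ℂ) {k n : ℤ} (h : n < k) :
    (binomialLaurent α k).coeff n = 0 := by
  rw [binomialLaurent, coeff_single_mul, one_mul, PowerSeries.coeff_coe, if_pos (by lia)]

theorem binomialLaurent_mul (α β : ℂ) (k l : ℤ) :
    binomialLaurent α k * binomialLaurent β l = binomialLaurent (α + β) (k + l) := by
  rw [binomialLaurent, binomialLaurent, mul_mul_mul_comm, single_mul_single, one_mul, ← map_mul,
    ← PowerSeries.binomialSeries_add, binomialLaurent]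

theorem single_eq_binomialLaurent (k : ℤ) : (single k 1 : ℂ⸨X⸩) = binomialLaurent 0 k := by
  rw [binomialLaurent, PowerSeries.binomialSeries_zero, (ofPowerSeries ℤ ℂ).map_one, mul_one]

theorem single_mul_binomialLaurent (α : ℂ) (j k : ℤ) :
    single j 1 * binomialLaurent α k = binomialLaurent α (j + k) := by
  rw [single_eq_binomialLaurent, binomialLaurent_mul, zero_add]

theorem binomialLaurent_add_one (α : ℂ) (k : ℤ) :
    binomialLaurent (α + 1) k = binomialLaurent α k + binomialLaurent α (k + 1) := by
  have h : binomialLaurent 1 0 = 1 + single 1 1 := by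
    have := PowerSeries.binomialSeries_nat (R := ℂ) (A := ℂ) 1
    rw [Nat.cast_one, pow_one] at this
    rw [binomialLaurent, this, map_add, (ofPowerSeries ℤ ℂ).map_one, PowerSeries.coe_X,
      single_zero_one, one_mul]
  rw [← add_zero k, ← binomialLaurent_mul, h, mul_add, mul_one, add_zero, mul_comm,
    single_mul_binomialLaurent, add_comm 1 k]

theorem choose_mul_coeff_binomialLaurent (α : ℂ) (k : ℤ) (q t : ℕ) :
    Ring.choose α q * (binomialLaurent (α - q) k).coeff (k + t - q) =
      Ring.choose (t : ℂ) q * Ring.choose α t := by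
  rw [Ring.choose_natCast]
  rcases le_or_gt q t with h | h
  · rw [show k + t - q = k + ((t - q : ℕ) : ℤ) by lia, coeff_binomialLaurent_add,
      choose_mul_choose_sub α h]
  · rw [coeff_binomialLaurent_of_lt _ (by lia), Nat.choose_eq_zero_of_lt h, Nat.cast_zero,
      zero_mul, mul_zero]

theorem hasseDeriv_binomialLaurent (α : ℂ) (m : ℤ) (s : ℕ) :
    hasseDeriv ℂ s (binomialLaurent α m) =
      ∑ q ∈ antidiagonal s, (Ring.choose α q.1 * Ring.choose (m : ℂ) q.2) •
        binomialLaurent (α - q.1) (m - q.2) := by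
  ext n
  rw [hasseDeriv_coeff, coeff_sum]
  simp only [coeff_smul, smul_eq_mul, zsmul_eq_mul]
  rcases lt_or_ge (n + s) m with h | h
  · rw [coeff_binomialLaurent_of_lt α h, mul_zero]
    refine (Finset.sum_eq_zero fun q hq => ?_).symm
    rw [mem_antidiagonal] at hq
    rw [coeff_binomialLaurent_of_lt _ (by lia), mul_zero]
  obtain ⟨t, ht⟩ := Int.le.dest h
  have hterm : ∀ q ∈ antidiagonal s,
      Ring.choose α q.1 * Ring.choose (m : ℂ) q.2 *
        (binomialLaurent (α - q.1) (m - q.2)).coeff n =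
      Ring.choose (t : ℂ) q.1 * Ring.choose (m : ℂ) q.2 * Ring.choose α t := by
    intro q hq
    rw [mem_antidiagonal] at hq
    rw [mul_right_comm, show n = m - q.2 + t - q.1 by lia, choose_mul_coeff_binomialLaurent,
      mul_right_comm]
  rw [Finset.sum_congr rfl hterm, ← Finset.sum_mul, ← Ring.add_choose_eq s (Commute.all _ _),
    ← ht, coeff_binomialLaurent_add, intCast_choose, add_comm m, Int.cast_add, Int.cast_natCast]

theorem hasseDeriv_binomialLaurent_zero (α : ℂ) (s : ℕ) :
    hasseDeriv ℂ s (binomialLaurent α 0) = Ring.choose α s • binomialLaurent (α - s) 0 := by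
  rw [hasseDeriv_binomialLaurent, Finset.sum_eq_single (s, 0)]
  · rw [Ring.choose_zero_right, mul_one, Nat.cast_zero, sub_zero]
  · rintro ⟨i, j⟩ hij hne
    have hj : 0 < j := Nat.pos_of_ne_zero fun hj =>
      hne (Prod.ext (by simpa [hj] using hij) hj)
    rw [Int.cast_zero, Ring.choose_zero_pos _ hj, mul_zero]
    exact zero_smul ℂ (binomialLaurent _ _)
  · exact fun h => (h (mem_antidiagonal.2 (add_zero s))).elim

theorem hasseDeriv_single_mul_single {R : Type*} [CommRing R] (s : ℕ) (m n : ℤ) :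
    hasseDeriv R s (single m 1) * (single n 1 : R⸨X⸩) =
      ((Ring.choose m s : ℤ) : R) • single (m + n - s) 1 := by
  rw [hasseDeriv_single, zsmul_one, single_mul_single, mul_one, sub_add_eq_add_sub,
    ← single_zero_mul_eq_smul, single_mul_single, zero_add, mul_one]

end BinomialLaurent

namespace VertexOperatorAlgebra

variable {V : Type*} [AddCommGroup V] [Module ℂ V]

/-! ### Residue calculus -/

section Residue

open LaurentSeries HahnSeries

variable (A : VertexOperatorAlgebra V)

/-- The bilinear map sending `u` and `v` to the functional `F ↦ Res_z F(z) Y(u,z)v` on Laurent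
series. -/
def res : V →ₗ[ℂ] V →ₗ[ℂ] ℂ⸨X⸩ →ₗ[ℂ] V :=
  have h (u v : V) := vanishesAtHighOrder_residuePairing (R := ℂ) (A.mode_eventually_zero u v)
  LinearMap.mk₂ ℂ (fun u v => residuePairing (fun n => A.mode u n v) (A.mode_eventually_zero u v))
    (fun u u' v => (h _ _).ext ((h _ _).add (h _ _)) fun n => by
      simp only [LinearMap.add_apply, residuePairing_single, mode_add])
    (fun c u v => (h _ _).ext ((h _ _).smul c) fun n => by
      simp only [LinearMap.smul_apply, residuePairing_single, mode_smul])
    (fun u v v' => (h _ _).ext ((h _ _).add (h _ _)) fun n => by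
      simp only [LinearMap.add_apply, residuePairing_single, map_add])
    (fun c u v => (h _ _).ext ((h _ _).smul c) fun n => by
      simp only [LinearMap.smul_apply, residuePairing_single, map_smul])

theorem res_single (u v : V) (n : ℤ) : A.res u v (single n 1) = A.mode u n v :=
  residuePairing_single (A.mode_eventually_zero u v) n

theorem vanishesAtHighOrder_res (u v : V) : VanishesAtHighOrder (A.res u v) :=
  vanishesAtHighOrder_residuePairing (A.mode_eventually_zero u v)

theorem residue_eq_res (α : ℂ) (k : ℤ) (u v : V) :
    A.residue α k u v = A.res u v (binomialLaurent α k) := by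
  have hinj : Function.Injective fun i : ℕ => k + (i : ℤ) :=
    (add_right_injective k).comp Nat.cast_injective
  have hsupp : (Function.support fun n => (binomialLaurent α k).coeff n • A.mode u n v) ⊆
      Set.range fun i : ℕ => k + (i : ℤ) := by
    intro n hn
    have hkn : k ≤ n := by
      by_contra h
      exact hn (by simp only [coeff_binomialLaurent_of_lt α (not_le.1 h), zero_smul])
    exact ⟨(n - k).toNat, by simp only; lia⟩
  change _ = ∑ᶠ n : ℤ, (binomialLaurent α k).coeff n • A.mode u n v
  rw [residue_apply, ← finsum_mem_univ (fun n : ℤ => _ • _),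
    finsum_mem_inter_support_eq (t := Set.range fun i : ℕ => k + (i : ℤ)), finsum_mem_range hinj]
  · exact finsum_congr fun i => by rw [coeff_binomialLaurent_add]
  · rw [Set.univ_inter, Set.inter_eq_right.2 hsupp]

theorem res_single_mul_eventually_zero (b c : V) (G : ℂ⸨X⸩) :
    ∃ N : ℕ, ∀ i, N ≤ i → A.res b c (single (i : ℤ) 1 * G) = 0 := by
  obtain ⟨K, hK⟩ := A.vanishesAtHighOrder_res b c
  exact ⟨(K - G.order).toNat, fun i hi =>
    hK _ ((WithTop.coe_le_coe.2 (by lia)).trans (le_orderTop_single_mul i G))⟩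

theorem iteratedRes_finite (l : ℤ) (a b c : V) (F G : ℂ⸨X⸩) :
    (Function.support fun i : ℕ => ((-1 : ℂ) ^ i * Ring.choose (l : ℂ) i) •
      A.res a (A.res b c (single (i : ℤ) 1 * G)) (single (l - i) 1 * F)).Finite := by
  obtain ⟨N, hN⟩ := A.res_single_mul_eventually_zero b c G
  refine (Set.finite_Iio N).subset fun i hi => Set.mem_Iio.2 (not_le.1 fun h => hi ?_)
  simp only [hN i h, map_zero, LinearMap.zero_apply, smul_zero]

/-- The bilinear map `(F, G) ↦ Res_{z₁} Res_{z₂} (z₁ - z₂)^l F(z₁) G(z₂) Y(a,z₁) Y(b,z₂) c`, with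
`(z₁ - z₂)^l` expanded in nonnegative powers of `z₂`. -/
def iteratedRes (l : ℤ) (a b c : V) : ℂ⸨X⸩ →ₗ[ℂ] ℂ⸨X⸩ →ₗ[ℂ] V :=
  LinearMap.mk₂ ℂ (fun F G => ∑ᶠ i : ℕ, ((-1 : ℂ) ^ i * Ring.choose (l : ℂ) i) •
      A.res a (A.res b c (single (i : ℤ) 1 * G)) (single (l - i) 1 * F))
    (fun F F' G => by
      rw [← finsum_add_distrib (A.iteratedRes_finite l a b c F G)
        (A.iteratedRes_finite l a b c F' G)]
      exact finsum_congr fun i => by rw [mul_add, map_add, smul_add])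
    (fun t F G => by
      rw [smul_finsum]
      exact finsum_congr fun i => by rw [laurent_mul_smul, map_smul, smul_comm])
    (fun F G G' => by
      rw [← finsum_add_distrib (A.iteratedRes_finite l a b c F G)
        (A.iteratedRes_finite l a b c F G')]
      exact finsum_congr fun i => by
        rw [mul_add, map_add, map_add, LinearMap.add_apply, smul_add])
    (fun t F G => by
      rw [smul_finsum]
      exact finsum_congr fun i => by
        rw [laurent_mul_smul, map_smul, map_smul, LinearMap.smul_apply, smul_comm])

theorem iteratedRes_apply (l : ℤ) (a b c : V) (F G : ℂ⸨X⸩) :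
    A.iteratedRes l a b c F G = ∑ᶠ i : ℕ, ((-1 : ℂ) ^ i * Ring.choose (l : ℂ) i) •
      A.res a (A.res b c (single (i : ℤ) 1 * G)) (single (l - i) 1 * F) := rfl

theorem vanishesAtHighOrder_iteratedRes (l : ℤ) (a b c : V) (F : ℂ⸨X⸩) :
    VanishesAtHighOrder (A.iteratedRes l a b c F) := by
  obtain ⟨K, hK⟩ := A.vanishesAtHighOrder_res b c
  refine ⟨K, fun G hG => finsum_eq_zero_of_forall_eq_zero fun i => ?_⟩
  have hi : (K : WithTop ℤ) ≤ (single (i : ℤ) (1 : ℂ) * G).orderTop := by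
    refine le_trans ?_ orderTop_add_le_mul
    rw [orderTop_single one_ne_zero, ← zero_add (K : WithTop ℤ)]
    exact add_le_add (WithTop.coe_le_coe.2 (Nat.cast_nonneg i)) hG
  rw [hK _ hi, map_zero, LinearMap.zero_apply, smul_zero]

theorem vanishesAtHighOrder_iteratedRes_flip (l : ℤ) (a b c : V) (G : ℂ⸨X⸩) :
    VanishesAtHighOrder ((A.iteratedRes l a b c).flip G) := by
  obtain ⟨N, hN⟩ := A.res_single_mul_eventually_zero b c G
  have h : (A.iteratedRes l a b c).flip G = ∑ i ∈ Finset.range N,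
      ((-1 : ℂ) ^ i * Ring.choose (l : ℂ) i) •
        (A.res a (A.res b c (single (i : ℤ) 1 * G)) ∘ₗ laurentMul ℂ (single (l - i) 1)) := by
    ext F
    rw [LinearMap.flip_apply, iteratedRes_apply, finsum_eq_sum_range (N := N), LinearMap.sum_apply]
    · rfl
    · intro i hi
      rw [hN i hi, map_zero, LinearMap.zero_apply, smul_zero]
  rw [h]
  exact .sum _ fun i _ => ((A.vanishesAtHighOrder_res _ _).comp_laurentMul _).smul _

theorem iteratedRes_single (l m n : ℤ) (a b c : V) :
    A.iteratedRes l a b c (single m 1) (single n 1) =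
      ∑ᶠ i : ℕ, ((-1 : ℤ) ^ i * Ring.choose l i) • A.mode a (m + l - i) (A.mode b (n + i) c) := by
  refine finsum_congr fun i => ?_
  rw [single_mul_single, single_mul_single, mul_one, res_single, res_single, ← intCast_choose,
    ← Int.cast_smul_eq_zsmul ℂ]
  push_cast
  rw [add_comm (i : ℤ) n, show l - i + m = m + l - i by ring]

/-- The bilinear map
`(F, G) ↦ Res_{z₂} Res_{z₁ - z₂} (z₁ - z₂)^l F(z₁) G(z₂) Y(Y(a,z₁ - z₂)b,z₂) c`, with `F(z₁)`
expanded in nonnegative powers of `z₁ - z₂`. -/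
def compositeRes (l : ℤ) (a b c : V) : ℂ⸨X⸩ →ₗ[ℂ] ℂ⸨X⸩ →ₗ[ℂ] V :=
  ∑ᶠ s : ℕ, (laurentMul ℂ ∘ₗ hasseDeriv ℂ s).compr₂ (A.res (A.mode a (l + s) b) c)

theorem exists_compositeRes_eq_sum (l : ℤ) (a b c : V) :
    ∃ N, (∀ s : ℕ, N ≤ s → A.mode a (l + s) b = 0) ∧ A.compositeRes l a b c =
      ∑ s ∈ Finset.range N,
        (laurentMul ℂ ∘ₗ hasseDeriv ℂ s).compr₂ (A.res (A.mode a (l + s) b) c) := by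
  obtain ⟨K, hK⟩ := A.mode_eventually_zero a b
  have hN : ∀ s : ℕ, (K - l).toNat ≤ s → A.mode a (l + s) b = 0 := fun s hs => hK _ (by lia)
  refine ⟨(K - l).toNat, hN, finsum_eq_sum_range fun s hs => ?_⟩
  rw [hN s hs, map_zero, LinearMap.zero_apply]
  rfl

theorem compositeRes_apply (l : ℤ) (a b c : V) (F G : ℂ⸨X⸩) :
    A.compositeRes l a b c F G =
      ∑ᶠ s : ℕ, A.res (A.mode a (l + s) b) c (hasseDeriv ℂ s F * G) := by
  obtain ⟨N, hN, h⟩ := A.exists_compositeRes_eq_sum l a b c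
  rw [h, LinearMap.sum_apply, LinearMap.sum_apply, finsum_eq_sum_range (N := N)]
  · rfl
  · intro s hs
    rw [hN s hs, map_zero, LinearMap.zero_apply, LinearMap.zero_apply]

theorem vanishesAtHighOrder_compositeRes (l : ℤ) (a b c : V) (F : ℂ⸨X⸩) :
    VanishesAtHighOrder (A.compositeRes l a b c F) := by
  obtain ⟨N, -, h⟩ := A.exists_compositeRes_eq_sum l a b c
  rw [h, LinearMap.sum_apply]
  exact .sum _ fun s _ => (A.vanishesAtHighOrder_res _ c).comp_laurentMul (hasseDeriv ℂ s F)

theorem vanishesAtHighOrder_compositeRes_flip (l : ℤ) (a b c : V) (G : ℂ⸨X⸩) :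
    VanishesAtHighOrder ((A.compositeRes l a b c).flip G) := by
  obtain ⟨N, -, h⟩ := A.exists_compositeRes_eq_sum l a b c
  have h_flip : (A.compositeRes l a b c).flip G = ∑ s ∈ Finset.range N,
      (A.res (A.mode a (l + s) b) c ∘ₗ (laurentMul ℂ).flip G) ∘ₗ hasseDeriv ℂ s := by
    ext F
    rw [LinearMap.flip_apply, h, LinearMap.sum_apply, LinearMap.sum_apply, LinearMap.sum_apply]
    rfl
  rw [h_flip]
  exact .sum _ fun s _ =>
    ((A.vanishesAtHighOrder_res _ c).comp_laurentMul_flip G).comp_hasseDeriv s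

theorem res_borcherds (l : ℤ) (a b c : V) (F G : ℂ⸨X⸩) :
    A.iteratedRes l a b c F G - (Int.negOnePow l : ℂ) • A.iteratedRes l b a c G F =
      ∑ᶠ s : ℕ, A.res (A.mode a (l + s) b) c (hasseDeriv ℂ s F * G) := by
  have key : A.iteratedRes l a b c - (Int.negOnePow l : ℂ) • (A.iteratedRes l b a c).flip =
      A.compositeRes l a b c := by
    refine VanishesAtHighOrder.ext₂
      (fun F => (A.vanishesAtHighOrder_iteratedRes l a b c F).sub
        ((A.vanishesAtHighOrder_iteratedRes_flip l b a c F).smul _))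
      (A.vanishesAtHighOrder_compositeRes l a b c)
      (fun G => (A.vanishesAtHighOrder_iteratedRes_flip l a b c G).sub
        ((A.vanishesAtHighOrder_iteratedRes l b a c G).smul _))
      (A.vanishesAtHighOrder_compositeRes_flip l a b c) fun m n => ?_
    have jacobi := A.jacobi a b c l m n
    rw [← Int.cast_smul_eq_zsmul ℂ] at jacobi
    rw [compositeRes_apply]
    refine (congrArg₂ (· - _ • ·) (A.iteratedRes_single ..) (A.iteratedRes_single ..)).trans
      (jacobi.trans (finsum_congr fun s => ?_))
    rw [hasseDeriv_single_mul_single, map_smul, res_single, Int.cast_smul_eq_zsmul]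
  exact (LinearMap.congr_fun₂ key F G).trans (A.compositeRes_apply l a b c F G)

theorem iteratedRes_zero (a b c : V) (F G : ℂ⸨X⸩) :
    A.iteratedRes 0 a b c F G = A.res a (A.res b c G) F := by
  rw [iteratedRes_apply, finsum_eq_single _ 0]
  · simp only [pow_zero, Ring.choose_zero_right, mul_one, one_smul, Nat.cast_zero, sub_zero,
      single_zero_one, one_mul]
  · intro i hi
    rw [Int.cast_zero, Ring.choose_zero_pos _ (Nat.pos_of_ne_zero hi), mul_zero, zero_smul]

theorem iteratedRes_binomialLaurent (l : ℤ) (α β : ℂ) (m n : ℤ) (a b c : V) :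
    A.iteratedRes l a b c (binomialLaurent α m) (binomialLaurent β n) =
      ∑ᶠ i : ℕ, ((-1 : ℂ) ^ i * Ring.choose (l : ℂ) i) •
        A.residue α (l - i + m) a (A.residue β (n + i) b c) := by
  refine finsum_congr fun i => ?_
  rw [residue_eq_res, residue_eq_res, single_mul_binomialLaurent, single_mul_binomialLaurent,
    add_comm n]

theorem residue_residue_finite (l : ℤ) (α β : ℂ) (n : ℤ) (a b c : V) :
    (Function.support fun i : ℕ => ((-1 : ℂ) ^ i * Ring.choose (l : ℂ) i) •
      A.residue α (l - i) a (A.residue β (n + i) b c)).Finite := by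
  have h := A.iteratedRes_finite l a b c (binomialLaurent α 0) (binomialLaurent β n)
  simpa only [single_mul_binomialLaurent, ← residue_eq_res, add_zero, add_comm _ n] using h

theorem residue_commutator (α β : ℂ) (m n : ℤ) (a b c : V) :
    A.residue α m a (A.residue β n b c) - A.residue β n b (A.residue α m a c) =
      ∑ᶠ s : ℕ, ∑ q ∈ antidiagonal s, (Ring.choose α q.1 * Ring.choose (m : ℂ) q.2) •
        A.residue (α + β - q.1) (m + n - q.2) (A.mode a s b) c := by
  have h := A.res_borcherds 0 a b c (binomialLaurent α m) (binomialLaurent β n)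
  rw [iteratedRes_zero, iteratedRes_zero, Int.negOnePow_zero, Units.val_one, Int.cast_one,
    one_smul] at h
  simp only [residue_eq_res]
  rw [h]
  refine finsum_congr fun s => ?_
  rw [zero_add, hasseDeriv_binomialLaurent, Finset.sum_mul, map_sum]
  refine Finset.sum_congr rfl fun q _ => ?_
  rw [mul_comm, laurent_mul_smul, binomialLaurent_mul, map_smul, add_sub, add_sub, add_comm β,
    add_comm n]

theorem residue_iterate (α β : ℂ) (l n : ℤ) (a b c : V) :
    ∑ᶠ s : ℕ, Ring.choose α s • A.residue (α + β - s) n (A.mode a (l + s) b) c =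
      (∑ᶠ i : ℕ, ((-1 : ℂ) ^ i * Ring.choose (l : ℂ) i) •
        A.residue α (l - i) a (A.residue β (n + i) b c)) -
      (Int.negOnePow l : ℂ) • ∑ᶠ i : ℕ, ((-1 : ℂ) ^ i * Ring.choose (l : ℂ) i) •
        A.residue β (l - i + n) b (A.residue α i a c) := by
  have h := A.res_borcherds l a b c (binomialLaurent α 0) (binomialLaurent β n)
  rw [iteratedRes_binomialLaurent, iteratedRes_binomialLaurent] at h
  simp only [add_zero, zero_add] at h
  rw [h]
  refine finsum_congr fun s => ?_
  rw [hasseDeriv_binomialLaurent_zero, residue_eq_res, mul_comm, laurent_mul_smul,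
    binomialLaurent_mul, map_smul, add_zero, add_sub, add_comm β]

theorem residue_add_one (α : ℂ) (k : ℤ) (u v : V) :
    A.residue (α + 1) k u v = A.residue α k u v + A.residue α (k + 1) u v := by
  rw [residue_eq_res, residue_eq_res, residue_eq_res, binomialLaurent_add_one, map_add]

theorem L_neg_one_mode (u : V) (n : ℤ) :
    A.mode (A.L (-1) u) n = (-(n : ℂ)) • A.mode u (n - 1) := A.L_neg_one u n

theorem res_L_neg_one (u v : V) :
    A.res (A.L (-1) u) v = (-1 : ℂ) • A.res u v ∘ₗ hasseDeriv ℂ 1 := by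
  refine (A.vanishesAtHighOrder_res _ _).ext
    (((A.vanishesAtHighOrder_res u v).comp_hasseDeriv 1).smul _) fun n => ?_
  have h := hasseDeriv_single_mul_single (R := ℂ) 1 n 0
  rw [single_zero_one, mul_one, Ring.choose_one_right, add_zero, Nat.cast_one] at h
  rw [res_single, L_neg_one_mode, LinearMap.smul_apply, LinearMap.smul_apply, LinearMap.comp_apply,
    h, map_smul, res_single, neg_smul, neg_one_smul]

theorem residue_L_neg_one (α : ℂ) (k : ℤ) (u v : V) :
    A.residue α k (A.L (-1) u) v =
      -(α • A.residue (α - 1) k u v) - (k : ℂ) • A.residue α (k - 1) u v := by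
  simp only [residue_eq_res]
  rw [res_L_neg_one, LinearMap.smul_apply, LinearMap.comp_apply, hasseDeriv_binomialLaurent,
    Finset.Nat.antidiagonal_succ]
  simp [neg_add_eq_sub]

theorem residue_mem (S : Submodule ℂ V) {u v : V} (h : ∀ n, A.mode u n v ∈ S) (α : ℂ) (k : ℤ) :
    A.residue α k u v ∈ S := by
  rw [residue_eq_res]
  exact residuePairing_mem (A.mode_eventually_zero u v) S h _

theorem residue_eq_sum_range {k : ℤ} {u v : V} {N : ℕ} (h : ∀ n, k + N ≤ n → A.mode u n v = 0)
    (α : ℂ) :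
    A.residue α k u v = ∑ i ∈ Finset.range N, Ring.choose α i • A.mode u (k + i) v := by
  rw [residue_apply, finsum_eq_sum_range (N := N)]
  intro i hi
  rw [h _ (by lia), smul_zero]

theorem residue_neg_one_vacuum (α : ℂ) (u : V) : A.residue α (-1) u A.vacuum = u := by
  have h : ∀ n : ℤ, -1 + (1 : ℕ) ≤ n → A.mode u n A.vacuum = 0 :=
    fun n hn => A.creation_nonneg u n (by lia)
  rw [A.residue_eq_sum_range h, Finset.sum_range_one, Ring.choose_zero_right, one_smul,
    Nat.cast_zero, add_zero]
  exact A.creation u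

theorem finsum_choose_smul_residue (α β : ℂ) (m : ℤ) (u v : V) :
    ∑ᶠ i : ℕ, ((-1 : ℂ) ^ i * Ring.choose α i) • A.residue (β - i) (m + i) u v =
      A.residue (β - α) m u v := by
  obtain ⟨N, hN⟩ := A.mode_eventually_zero u v
  simp only [residue_apply, smul_finsum]
  rw [finsum_finsum_eq_finsum_antidiagonal (N := (N - m).toNat) fun i k h => by
    rw [hN _ (by lia), smul_zero, smul_zero]]
  refine finsum_congr fun s => ?_
  rw [← sum_antidiagonal_neg_one_pow_choose, Finset.sum_smul]
  refine Finset.sum_congr rfl fun q hq => ?_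
  rw [smul_smul, ← mem_antidiagonal.1 hq, add_assoc, Nat.cast_add]

end Residue

/-! ### Gradings by weights and by eigenspaces -/

section Grading

variable (A : VertexOperatorAlgebra V)

theorem L_commutator (m : ℕ) (a w : V) (n : ℤ) :
    A.L (m - 1) (A.mode a n w) - A.mode a n (A.L (m - 1) w) =
      ∑ i ∈ Finset.range (m + 1), m.choose i • A.mode (A.L (i - 1) a) (m + n - i) w := by
  have h := A.jacobi A.omega a w 0 m n
  have h0 : ∀ i : ℕ, i ≠ 0 → Ring.choose (0 : ℤ) i = 0 := fun i hi =>
    Ring.choose_zero_pos _ (Nat.pos_of_ne_zero hi)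
  rw [finsum_eq_single _ 0 (fun i hi => by rw [h0 i hi, mul_zero, zero_smul]),
    finsum_eq_single _ 0 (fun i hi => by rw [h0 i hi, mul_zero, zero_smul]),
    finsum_eq_sum_range (N := m + 1)] at h
  · simpa [L, Ring.choose_natCast] using h
  · intro i hi
    rw [Ring.choose_natCast, Nat.choose_eq_zero_of_lt hi, Nat.cast_zero, zero_smul]

theorem L_zero_apply {n : ℤ} {v : V} (hv : v ∈ A.wt n) : A.L 0 v = (n : ℂ) • v :=
  A.L_zero n v hv

theorem L_zero_mode (a w : V) (n : ℤ) :
    A.L 0 (A.mode a n w) = A.mode a n (A.L 0 w) - (n + 1 : ℂ) • A.mode a n w +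
      A.mode (A.L 0 a) n w := by
  have h := A.L_commutator 1 a w n
  simp only [Nat.cast_one, sub_self, Nat.reduceAdd, Finset.sum_range_succ, Finset.range_one,
    Finset.sum_singleton, Nat.choose_succ_self_right, zero_add, Nat.cast_zero, zero_sub, sub_zero,
    L_neg_one_mode, Int.cast_add, Int.cast_one, neg_add_rev, add_sub_cancel_left,
    LinearMap.smul_apply, one_smul, Nat.choose_self] at h
  rw [sub_eq_iff_eq_add.1 h]
  module

theorem L_one_mode {p : ℤ} {a : V} (ha : a ∈ A.wt p) (w : V) (n : ℤ) :
    A.L 1 (A.mode a n w) = A.mode a n (A.L 1 w) + (2 * p - n - 2 : ℂ) • A.mode a (n + 1) w +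
      A.mode (A.L 1 a) n w := by
  have h := A.L_commutator 2 a w n
  simp only [Nat.cast_ofNat, Int.reduceSub, Nat.reduceAdd, Finset.sum_range_succ, Finset.range_one,
    Finset.sum_singleton, Nat.choose_zero_right, Nat.cast_zero, zero_sub, sub_zero, L_neg_one_mode,
    Int.cast_add, Int.cast_ofNat, neg_add_rev, LinearMap.smul_apply, one_smul,
    Nat.choose_succ_self_right, Nat.cast_one, sub_self, A.L_zero_apply ha, mode_smul,
    Nat.choose_self, add_sub_cancel_left] at h
  rw [show 2 + n - 1 = n + 1 by ring] at h
  rw [sub_eq_iff_eq_add.1 h]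
  module

theorem mode_mem_wt {p q r : ℤ} {a b : V} (ha : a ∈ A.wt p) (hb : b ∈ A.wt q) (n : ℤ)
    (hr : r = p + q - n - 1) : A.mode a n b ∈ A.wt r := by
  apply A.mem_wt_of_L_zero
  rw [L_zero_mode, A.L_zero_apply hb, A.L_zero_apply ha, mode_smul, map_smul,
    LinearMap.smul_apply, hr]
  push_cast
  module

theorem L_neg_one_mem {n : ℤ} {v : V} (hv : v ∈ A.wt n) : A.L (-1) v ∈ A.wt (n + 1) :=
  A.mode_mem_wt A.omega_mem hv _ (by ring)

end Grading

section Automorphism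

variable {A : VertexOperatorAlgebra V} (g : A.Aut)

theorem aut_mode (u v : V) (n : ℤ) : g.1 (A.mode u n v) = A.mode (g.1 u) n (g.1 v) :=
  g.2.1 u v n

theorem aut_mem_wt {n : ℤ} {v : V} (hv : v ∈ A.wt n) : g.1 v ∈ A.wt n := by
  apply A.mem_wt_of_L_zero
  have h := aut_mode g A.omega v 1
  rw [g.2.2.2] at h
  rw [← map_smul, ← A.L_zero_apply hv]
  exact h.symm

theorem mem_eigen_iff {r : ℕ} {v : V} : v ∈ A.eigen g r ↔
    g.1 v = Complex.exp (2 * Real.pi * Complex.I / orderOf g) ^ r • v := by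
  rw [eigen, Module.End.mem_eigenspace_iff, ← Complex.exp_nat_mul, mul_div_left_comm,
    mul_div_assoc, LinearEquiv.coe_coe]

theorem mode_mem_eigen {r s : ℕ} {a b : V} (ha : a ∈ A.eigen g r) (hb : b ∈ A.eigen g s) (n : ℤ) :
    A.mode a n b ∈ A.eigen g (r + s) := by
  rw [mem_eigen_iff] at *
  rw [aut_mode, ha, hb, mode_smul, map_smul, LinearMap.smul_apply, smul_smul, pow_add, mul_comm]

theorem residue_mem_eigen {r s : ℕ} {a b : V} (ha : a ∈ A.eigen g r) (hb : b ∈ A.eigen g s)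
    (α : ℂ) (k : ℤ) : A.residue α k a b ∈ A.eigen g (r + s) :=
  A.residue_mem _ (mode_mem_eigen g ha hb) α k

theorem omega_mem_eigen : A.omega ∈ A.eigen g 0 := by
  rw [mem_eigen_iff, pow_zero, one_smul]
  exact g.2.2.2

theorem vacuum_mem_eigen : A.vacuum ∈ A.eigen g 0 := by
  rw [mem_eigen_iff, pow_zero, one_smul]
  exact g.2.2.1

theorem L_mem_eigen {r : ℕ} {a : V} (ha : a ∈ A.eigen g r) (n : ℤ) : A.L n a ∈ A.eigen g r := by
  have := mode_mem_eigen g (omega_mem_eigen g) ha (n + 1)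
  rwa [zero_add] at this

variable {g}

theorem L_one_pow_mem_eigen {r : ℕ} {a : V} (ha : a ∈ A.eigen g r) (j : ℕ) :
    (A.L 1 ^ j) a ∈ A.eigen g r :=
  Module.End.pow_apply_mem_of_forall_mem j (fun _ hv => L_mem_eigen g hv 1) a ha

theorem isPrimitiveRoot_exp_orderOf (hg : IsOfFinOrder g) :
    IsPrimitiveRoot (Complex.exp (2 * Real.pi * Complex.I / orderOf g)) (orderOf g) :=
  Complex.isPrimitiveRoot_exp _ hg.orderOf_pos.ne'

theorem eigen_mod (hg : IsOfFinOrder g) (r : ℕ) : A.eigen g (r % orderOf g) = A.eigen g r := by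
  ext v
  rw [mem_eigen_iff, mem_eigen_iff,
    ← pow_eq_pow_mod r (isPrimitiveRoot_exp_orderOf hg).pow_eq_one]

theorem mem_eigen_inv (hg : IsOfFinOrder g) {r s : ℕ} (hrs : orderOf g ∣ r + s) {u : V}
    (hu : u ∈ A.eigen g r) : u ∈ A.eigen g⁻¹ s := by
  rw [mem_eigen_iff] at hu ⊢
  rw [orderOf_inv]
  apply g.1.injective
  rw [map_smul, hu, smul_smul, ← pow_add, add_comm s,
    ((isPrimitiveRoot_exp_orderOf hg).pow_eq_one_iff_dvd _).2 hrs, one_smul]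
  exact g.1.apply_symm_apply u

theorem mem_of_homogeneous_mem (hg : IsOfFinOrder g) (S : Submodule ℂ V)
    (h : ∀ (n : ℤ) (r : ℕ) (u : V), r < orderOf g → u ∈ A.wt n → u ∈ A.eigen g r → u ∈ S)
    (v : V) : v ∈ S := by
  have : NeZero (orderOf g) := ⟨hg.orderOf_pos.ne'⟩
  suffices ⨆ n, A.wt n ≤ S from this (A.isInternal.submodule_iSup_eq_top ▸ Submodule.mem_top)
  refine iSup_le fun n => ?_
  have := A.finiteDimensional n
  let f : Module.End ℂ (A.wt n) := (g.1 : V →ₗ[ℂ] V).restrict fun _ => aut_mem_wt g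
  have f_pow : f ^ orderOf g = 1 := by
    have g_pow : g.1 ^ orderOf g = 1 := congrArg Subtype.val (pow_orderOf_eq_one g)
    ext v
    rw [Module.End.pow_restrict, LinearMap.coe_restrict_apply, Module.End.coe_pow,
      LinearEquiv.coe_coe, ← LinearEquiv.coe_pow, g_pow]
    rfl
  rw [← Submodule.comap_subtype_eq_top, eq_top_iff,
    ← iSup_eigenspace_eq_top_of_pow_eq_one (NeZero.ne _) f_pow]
  refine iSup_le fun μ u hu => ?_
  rcases eq_or_ne u 0 with rfl | hu0
  · exact Submodule.zero_mem _
  have hμ : μ ^ orderOf g = 1 := by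
    have hvec := (Module.End.hasEigenvector_iff.2 ⟨hu, hu0⟩).pow_apply (orderOf g)
    rw [f_pow, Module.End.one_apply] at hvec
    exact smul_left_injective ℂ hu0 (hvec.symm.trans (one_smul ℂ u).symm)
  obtain ⟨r, hr, rfl⟩ := (isPrimitiveRoot_exp_orderOf hg).eq_pow_of_pow_eq_one hμ
  exact h n r u hr u.2 ((mem_eigen_iff g).2
    (congrArg Subtype.val (Module.End.mem_eigenspace_iff.1 hu)))

end Automorphism

/-! ### The subspace `O_g(V)` and the product on `A_g(V)` -/

section Og

variable {A : VertexOperatorAlgebra V} {g : A.Aut}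

/-- The symbol `δ_r` in the exponents of `∘_g`, as a natural number: `1` if `r = 0`, and `0`
otherwise. -/
def delta (r : ℕ) : ℕ := if r = 0 then 1 else 0

theorem circ_eq_residue (n : ℤ) (r : ℕ) (u v : V) :
    A.circ g n r u v = A.residue (n - 1 + delta r + r / orderOf g) (-1 - delta r) u v := by
  simp only [circ, delta, Nat.cast_ite, Nat.cast_one, Nat.cast_zero]

theorem delta_add_div_add_div {T r s : ℕ} (hr : r < T) (hs : s < T) (hrs : T ∣ r + s) :
    delta s = delta r ∧ (delta r + r / T + s / T : ℂ) = 1 := by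
  obtain ⟨d, hd⟩ := hrs
  rcases Nat.eq_zero_or_pos r with rfl | hr0
  · obtain rfl : s = 0 := by
      have : d < 1 := lt_of_mul_lt_mul_left (by lia : T * d < T * 1) T.zero_le
      simp_all
    simp [delta]
  · have hd1 : d = 1 := by
      have : d < 2 := lt_of_mul_lt_mul_left (by lia : T * d < T * 2) T.zero_le
      interval_cases d <;> lia
    have hT : (T : ℂ) ≠ 0 := by
      exact_mod_cast (show T ≠ 0 by lia)
    rw [hd1, mul_one] at hd
    rw [delta, delta, if_neg (by lia), if_neg (by lia), Nat.cast_zero, zero_add, ← add_div,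
      ← Nat.cast_add, hd, div_self hT]
    exact ⟨rfl, rfl⟩

theorem residue_mem_Og_of_pole {p : ℤ} {r : ℕ} (hr : r < orderOf g) {u : V} (hp : u ∈ A.wt p)
    (hu : u ∈ A.eigen g r) (v : V) (m : ℕ) :
    A.residue (p - 1 + delta r + r / orderOf g) (-1 - delta r - m) u v ∈ A.Og g := by
  induction m generalizing p u with
  | zero =>
    refine Submodule.subset_span ⟨p, r, u, v, hr, hp, hu, ?_⟩
    rw [circ_eq_residue, Nat.cast_zero, sub_zero]
  | succ m ih =>
    -- The induction step is the residue of a total derivative, applied to `L(-1)u`.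
    have hL := ih (A.L_neg_one_mem hp) (L_mem_eigen g hu _)
    have hu := ih hp hu
    have hne : ((-1 - delta r - m : ℤ) : ℂ) ≠ 0 := by
      exact_mod_cast (show (-1 - delta r - m : ℤ) ≠ 0 by lia)
    have hexp : ((p + 1 : ℤ) : ℂ) - 1 + delta r + r / orderOf g =
        p - 1 + delta r + r / orderOf g + 1 := by
      push_cast
      ring
    rw [hexp, residue_L_neg_one, add_sub_cancel_right, residue_add_one, sub_add_cancel,
      Submodule.sub_mem_iff_right _ ((A.Og g).neg_mem ((A.Og g).smul_mem _ hu)),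
      Submodule.smul_mem_iff _ hne, Submodule.add_mem_iff_left _ hu] at hL
    rwa [Nat.cast_succ, ← sub_sub]

theorem residue_mem_Og {p : ℤ} {r : ℕ} (hr : r < orderOf g) {u : V} (hp : u ∈ A.wt p)
    (hu : u ∈ A.eigen g r) (v : V) {α : ℂ} {k : ℤ} {j m : ℕ} (hjm : j ≤ m)
    (hα : α = p - 1 + delta r + r / orderOf g + j) (hk : k = -1 - delta r - m) :
    A.residue α k u v ∈ A.Og g := by
  induction j generalizing α k m with
  | zero =>
    rw [hα, hk, Nat.cast_zero, add_zero]
    exact residue_mem_Og_of_pole hr hp hu v m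
  | succ j ih =>
    obtain ⟨m, rfl⟩ := Nat.exists_eq_add_of_le' (show 1 ≤ m by lia)
    rw [hα, Nat.cast_succ, ← add_assoc, residue_add_one]
    refine Submodule.add_mem _ (ih (m := m + 1) (by lia) rfl hk) (ih (m := m) (by lia) rfl ?_)
    rw [hk, Nat.cast_succ]
    ring

theorem residue_mem_Og_of_fixed (hg : IsOfFinOrder g) {p : ℤ} {u : V} (hp : u ∈ A.wt p)
    (hu : u ∈ A.eigen g 0) (v : V) {α : ℂ} {k : ℤ} {j m : ℕ} (hjm : j ≤ m)
    (hα : α = p + j) (hk : k = -2 - m) : A.residue α k u v ∈ A.Og g := by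
  refine residue_mem_Og hg.orderOf_pos hp hu v hjm ?_ ?_
  · rw [hα]
    simp [delta]
  · rw [hk]
    simp [delta]

theorem mem_Og_of_mem_eigen {p : ℤ} {r : ℕ} (h0 : r ≠ 0) (hr : r < orderOf g) {u : V}
    (hp : u ∈ A.wt p) (hu : u ∈ A.eigen g r) : u ∈ A.Og g := by
  have h := residue_mem_Og_of_pole hr hp hu A.vacuum 0
  simpa only [delta, if_neg h0, Nat.cast_zero, sub_zero, residue_neg_one_vacuum] using h

end Og

section Star

variable {A : VertexOperatorAlgebra V} {g : A.Aut}

theorem star_eq_residue (hg : IsOfFinOrder g) {n : ℤ} {u : V} (hn : u ∈ A.wt n)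
    (hu : u ∈ A.eigen g 0) (v : V) : A.star g u v = A.residue n (-1) u v :=
  A.star_apply_zero g hg hn hu v

theorem star_eq_zero_of_not_dvd (hg : IsOfFinOrder g) {r : ℕ} (h0 : ¬ orderOf g ∣ r) {u : V}
    (hu : u ∈ A.eigen g r) (v : V) : A.star g u v = 0 :=
  A.star_apply_pos g (Nat.pos_of_ne_zero (mt Nat.dvd_of_mod_eq_zero h0))
    (Nat.mod_lt _ hg.orderOf_pos) (by rwa [eigen_mod hg]) v

theorem star_residue (hg : IsOfFinOrder g) {n q : ℤ} {r s : ℕ} {a b : V} (ha : a ∈ A.wt n)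
    (hb : b ∈ A.wt q) (ha' : a ∈ A.eigen g r) (hb' : b ∈ A.eigen g s)
    (hrs : orderOf g ∣ r + s) {α β : ℂ} {l : ℤ} (h : α + β = n + q - l - 1) (c : V) :
    A.star g (A.residue α l a b) c =
      (∑ᶠ i : ℕ, ((-1 : ℂ) ^ i * Ring.choose (l : ℂ) i) •
        A.residue α (l - i) a (A.residue β (-1 + i) b c)) -
      (Int.negOnePow l : ℂ) • ∑ᶠ i : ℕ, ((-1 : ℂ) ^ i * Ring.choose (l : ℂ) i) •
        A.residue β (l - i + -1) b (A.residue α i a c) := by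
  rw [← residue_iterate, ← LinearMap.flip_apply, residue_apply,
    map_finsum _ (A.residue_finite α l a b)]
  refine finsum_congr fun i => ?_
  have hfixed : A.mode a (l + i) b ∈ A.eigen g 0 := by
    rw [← Nat.mod_eq_zero_of_dvd hrs, eigen_mod hg]
    exact mode_mem_eigen g ha' hb' _
  rw [LinearMap.flip_apply, map_smul, LinearMap.smul_apply,
    star_eq_residue hg (A.mode_mem_wt ha hb (l + i) rfl) hfixed, h]
  push_cast
  ring_nf

theorem star_mem_compatibleMaps (hg : IsOfFinOrder g) (c : V) :
    A.star g c ∈ Submodule.compatibleMaps (A.Og g) (A.Og g) := by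
  rw [← Submodule.mem_comap]
  refine mem_of_homogeneous_mem hg _ (fun p t c ht hp hc => ?_) c
  rcases Nat.eq_zero_or_pos t with rfl | ht0
  swap
  · have star_eq_zero : A.star g c = 0 := LinearMap.ext (A.star_apply_pos g ht0 ht hc)
    rw [Submodule.mem_comap, star_eq_zero]
    exact Submodule.zero_mem _
  refine Submodule.span_le.2 ?_
  rintro _ ⟨n, r, a, b, hr, hn, ha, rfl⟩
  rw [SetLike.mem_coe, Submodule.mem_comap, star_eq_residue hg hp hc, circ_eq_residue]
  have h_swap := residue_mem_Og_of_pole hr hn ha (A.residue p (-1) c b) 0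
  rw [Nat.cast_zero, sub_zero] at h_swap
  rw [← Submodule.sub_mem_iff_left _ h_swap, residue_commutator]
  refine finsum_mem_of_forall_mem _ fun s => Submodule.sum_mem _ fun q hq =>
    Submodule.smul_mem _ _ ?_
  have hmode := mode_mem_eigen g hc ha s
  rw [zero_add] at hmode
  refine residue_mem_Og hr (A.mode_mem_wt hp hn s rfl) hmode b (le_refl (q.2 + 1)) ?_ ?_
  · rw [← mem_antidiagonal.1 hq]
    push_cast
    ring
  · push_cast
    ring

theorem star_circ_mem_Og (hg : IsOfFinOrder g) {n : ℤ} {r : ℕ} {a : V} (hr : r < orderOf g)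
    (hn : a ∈ A.wt n) (ha : a ∈ A.eigen g r) (b c : V) :
    A.star g (A.circ g n r a b) c ∈ A.Og g := by
  rw [circ_eq_residue, ← LinearMap.flip_apply, ← LinearMap.comp_apply, ← Submodule.mem_comap]
  refine mem_of_homogeneous_mem hg _ (fun q s b hs hq hb => ?_) b
  rw [Submodule.mem_comap, LinearMap.comp_apply, LinearMap.flip_apply]
  by_cases hrs : orderOf g ∣ r + s
  swap
  · rw [star_eq_zero_of_not_dvd hg hrs (residue_mem_eigen g ha hb _ _)]
    exact Submodule.zero_mem _
  obtain ⟨delta_eq, sum_eq⟩ := delta_add_div_add_div hr hs hrs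
  rw [star_residue hg hn hq ha hb hrs (β := q - 1 + delta s + s / orderOf g + 1)]
  · refine Submodule.sub_mem _ ?_ (Submodule.smul_mem _ _ ?_)
    · exact finsum_mem_of_forall_mem _ fun i => Submodule.smul_mem _ _
        (residue_mem_Og_of_pole hr hn ha _ i)
    · refine finsum_mem_of_forall_mem _ fun i => Submodule.smul_mem _ _
        (residue_mem_Og (j := 1) (m := i + 1) hs hq hb _ (by lia) (by rw [Nat.cast_one]) ?_)
      rw [delta_eq]
      push_cast
      ring
  · rw [delta_eq]
    push_cast
    linear_combination sum_eq

theorem star_mem_Og_left (hg : IsOfFinOrder g) {x : V} (hx : x ∈ A.Og g) (c : V) :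
    A.star g x c ∈ A.Og g := by
  suffices A.Og g ≤ (A.Og g).comap ((A.star g).flip c) from this hx
  refine Submodule.span_le.2 ?_
  rintro _ ⟨n, r, a, b, hr, hn, ha, rfl⟩
  exact star_circ_mem_Og hg hr hn ha b c

variable (A g) in
/-- The product induced by `*_g` on `A_g(V)`. -/
def starQuotient (hg : IsOfFinOrder g) : A.Ag g →ₗ[ℂ] A.Ag g →ₗ[ℂ] A.Ag g :=
  (A.Og g).liftQ
    ((A.Og g).mapQLinear (A.Og g) ∘ₗ (A.star g).codRestrict _ (star_mem_compatibleMaps hg))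
    fun _ hx => LinearMap.mem_ker.2 <| Submodule.linearMap_qext _ <| LinearMap.ext fun c =>
      (Submodule.Quotient.mk_eq_zero _).2 (star_mem_Og_left hg hx c)

theorem starQuotient_mkQ (hg : IsOfFinOrder g) (u v : V) :
    A.starQuotient g hg ((A.Og g).mkQ u) ((A.Og g).mkQ v) = (A.Og g).mkQ (A.star g u v) := rfl

theorem mkQ_fixed_induction (hg : IsOfFinOrder g) {P : A.Ag g → Prop}
    (add : ∀ x y, P x → P y → P (x + y)) (smul : ∀ (c : ℂ) x, P x → P (c • x))
    (fixed : ∀ (n : ℤ) (u : V), u ∈ A.wt n → u ∈ A.eigen g 0 → P ((A.Og g).mkQ u))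
    (x : A.Ag g) : P x := by
  have zero : P 0 := fixed 0 0 (Submodule.zero_mem _) (Submodule.zero_mem _)
  let S : Submodule ℂ (A.Ag g) :=
    { carrier := {x | P x}
      add_mem' := fun {x y} => add x y
      zero_mem' := zero
      smul_mem' := smul }
  obtain ⟨v, rfl⟩ := (A.Og g).mkQ_surjective x
  refine mem_of_homogeneous_mem hg (S.comap (A.Og g).mkQ) (fun n r u hr hn hu => ?_) v
  rcases eq_or_ne r 0 with rfl | hr0
  · exact fixed n u hn hu
  · rw [Submodule.mem_comap, Submodule.mkQ_apply,
      (Submodule.Quotient.mk_eq_zero _).2 (mem_Og_of_mem_eigen hr0 hr hn hu)]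
    exact zero

theorem star_assoc (hg : IsOfFinOrder g) {n q : ℤ} {a b : V} (ha : a ∈ A.wt n) (hb : b ∈ A.wt q)
    (ha' : a ∈ A.eigen g 0) (hb' : b ∈ A.eigen g 0) (c : V) :
    A.star g (A.star g a b) c ≡ A.star g a (A.star g b c) [SMOD A.Og g] := by
  have main := finsum_smodEq_apply_zero (A.Og g) (A.residue_residue_finite (-1) n q (-1) a b c)
    fun i => Submodule.smul_mem _ _ (residue_mem_Og_of_fixed hg ha ha' _ (j := 0) (m := i)
      (Nat.zero_le i) (by rw [Nat.cast_zero, add_zero]) (by push_cast; ring))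
  have rest : ∑ᶠ i : ℕ, ((-1 : ℂ) ^ i * Ring.choose ((-1 : ℤ) : ℂ) i) •
      A.residue q (-1 - i + -1) b (A.residue n i a c) ∈ A.Og g :=
    finsum_mem_of_forall_mem _ fun i => Submodule.smul_mem _ _
      (residue_mem_Og_of_fixed hg hb hb' _ (j := 0) (m := i) (Nat.zero_le i)
        (by rw [Nat.cast_zero, add_zero]) (by ring))
  rw [star_eq_residue hg ha ha', star_eq_residue hg ha ha', star_eq_residue hg hb hb',
    star_residue hg ha hb ha' hb' (dvd_zero _) (β := q) (by push_cast; ring)]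
  simpa only [pow_zero, Ring.choose_zero_right, mul_one, one_smul, Nat.cast_zero, sub_zero,
    add_zero] using main.sub (SModEq.zero.2 (Submodule.smul_mem _ _ rest))

theorem starQuotient_assoc (hg : IsOfFinOrder g) (x y z : A.Ag g) :
    A.starQuotient g hg (A.starQuotient g hg x y) z =
      A.starQuotient g hg x (A.starQuotient g hg y z) := by
  obtain ⟨c, rfl⟩ := (A.Og g).mkQ_surjective z
  induction x using mkQ_fixed_induction hg with
  | add x x' hx hx' => simp only [map_add, LinearMap.add_apply, hx, hx']
  | smul t x hx => simp only [map_smul, LinearMap.smul_apply, hx]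
  | fixed n a ha ha' =>
  induction y using mkQ_fixed_induction hg with
  | add y y' hy hy' => simp only [map_add, LinearMap.add_apply, hy, hy']
  | smul t y hy => simp only [map_smul, LinearMap.smul_apply, hy]
  | fixed q b hb hb' => exact star_assoc hg ha hb ha' hb' c

theorem vacuum_star (hg : IsOfFinOrder g) (x : V) : A.star g A.vacuum x = x := by
  rw [star_eq_residue hg A.vacuum_mem (vacuum_mem_eigen g), residue_apply, finsum_eq_single _ 0]
  · simp [mode, A.vacuum_mode]
  · intro i hi
    rw [mode, A.vacuum_mode, if_neg (by lia), smul_zero]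

theorem starQuotient_vacuum (hg : IsOfFinOrder g) (x : A.Ag g) :
    A.starQuotient g hg x ((A.Og g).mkQ A.vacuum) = x := by
  induction x using mkQ_fixed_induction hg with
  | add x x' hx hx' => rw [map_add, LinearMap.add_apply, hx, hx']
  | smul t x hx => rw [map_smul, LinearMap.smul_apply, hx]
  | fixed n a ha ha' =>
    rw [starQuotient_mkQ, star_eq_residue hg ha ha', residue_neg_one_vacuum]

theorem residue_vacuum_smodEq (hg : IsOfFinOrder g) {p : ℤ} {w : V} (hp : w ∈ A.wt p)
    (hw : w ∈ A.eigen g 0) (j : ℕ) : A.residue (p + j) (-1 - j) w A.vacuum ≡ w [SMOD A.Og g] := by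
  induction j with
  | zero => rw [Nat.cast_zero, Nat.cast_zero, add_zero, sub_zero, residue_neg_one_vacuum]
  | succ j ih =>
    have h := residue_mem_Og_of_fixed hg hp hw A.vacuum le_rfl rfl
      (show (-1 - (j + 1 : ℕ) : ℤ) = -2 - j by push_cast; ring)
    rw [Nat.cast_succ, ← add_assoc, residue_add_one,
      show (-1 - (j + 1 : ℕ) + 1 : ℤ) = -1 - j by push_cast; ring]
    simpa only [zero_add] using (SModEq.zero.2 h).add ih

theorem star_sub_star_smodEq_residue (hg : IsOfFinOrder g) {n q : ℤ} {a b : V} (ha : a ∈ A.wt n)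
    (hb : b ∈ A.wt q) (ha' : a ∈ A.eigen g 0) (hb' : b ∈ A.eigen g 0) :
    A.star g a b - A.star g b a ≡ A.residue (n - 1) 0 a b [SMOD A.Og g] := by
  have commutator : A.star g a b - A.star g b a =
      A.residue n (-1) a (A.residue q (-1) b A.vacuum) -
        A.residue q (-1) b (A.residue n (-1) a A.vacuum) := by
    rw [residue_neg_one_vacuum, residue_neg_one_vacuum, star_eq_residue hg ha ha',
      star_eq_residue hg hb hb']
  obtain ⟨M, hM⟩ := A.mode_eventually_zero a b
  have mode_eq_zero : ∀ s : ℕ, M.toNat ≤ s → A.mode a s b = 0 := fun s hs => hM s (by lia)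
  rw [commutator, residue_commutator, residue_apply, finsum_eq_sum_range (N := M.toNat),
    finsum_eq_sum_range (N := M.toNat)]
  · refine SModEq.sum fun s _ => ?_
    rw [sub_eq_add_neg (n : ℂ), Ring.add_choose_eq _ (Commute.all _ _), Finset.sum_smul]
    refine SModEq.sum fun t ht => ?_
    have h := residue_vacuum_smodEq hg (A.mode_mem_wt ha hb s rfl) (mode_mem_eigen g ha' hb' s)
      (t.2 + 1)
    convert h.smul _ using 3
    · congr 2
      · rw [← mem_antidiagonal.1 ht]
        push_cast
        ring
      · push_cast
        ring
    · rw [Int.cast_neg, Int.cast_one]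
    · rw [zero_add]
  · intro s hs
    rw [zero_add, mode_eq_zero s hs, smul_zero]
  · intro s hs
    simp only [mode_eq_zero s hs, map_zero, LinearMap.zero_apply, smul_zero,
      Finset.sum_const_zero]

theorem residue_smodEq_star (hg : IsOfFinOrder g) {n q : ℤ} {a b : V} (ha : a ∈ A.wt n)
    (hb : b ∈ A.wt q) (ha' : a ∈ A.eigen g 0) (hb' : b ∈ A.eigen g 0) :
    A.residue (n - 1) (-1) a b ≡ A.star g b a [SMOD A.Og g] := by
  have h := star_sub_star_smodEq_residue hg ha hb ha' hb'
  have split := A.residue_add_one (n - 1) (-1) a b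
  rw [sub_add_cancel, neg_add_cancel] at split
  rw [star_eq_residue hg ha ha', split, SModEq.sub_mem] at h
  rw [SModEq.sub_mem]
  convert h using 1
  abel

theorem residue_omega_mem_Og (hg : IsOfFinOrder g) {n : ℤ} {u : V} (hn : u ∈ A.wt n)
    (hu : u ∈ A.eigen g 0) : A.residue 1 0 A.omega u ∈ A.Og g := by
  have L_neg_one_eq : A.L (-1) u = A.mode u (-2) A.vacuum := by
    have h := A.creation (A.L (-1) u)
    rw [← mode, L_neg_one_mode, Int.cast_neg, Int.cast_one, neg_neg, one_smul] at h
    exact h.symm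
  have left : A.residue 1 0 A.omega u = A.L (-1) u + A.L 0 u := by
    rw [residue_apply, finsum_eq_sum_range (N := 2)]
    · simp [Finset.sum_range_succ, L]
    · intro i hi
      rw [← Nat.cast_one, Ring.choose_natCast, Nat.choose_eq_zero_of_lt (by lia), Nat.cast_zero,
        zero_smul]
  have right : A.residue n (-2) u A.vacuum = A.mode u (-2) A.vacuum + (n : ℂ) • u := by
    rw [A.residue_eq_sum_range (N := 2) fun m hm => A.creation_nonneg u m (by lia)]
    simp [Finset.sum_range_succ, mode, A.creation]
  rw [left, L_neg_one_eq, A.L_zero_apply hn, ← right]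
  exact residue_mem_Og_of_fixed hg hn hu _ (le_refl 0) (by rw [Nat.cast_zero, add_zero]) rfl

theorem starQuotient_omega_comm (hg : IsOfFinOrder g) (x : A.Ag g) :
    A.starQuotient g hg ((A.Og g).mkQ A.omega) x =
      A.starQuotient g hg x ((A.Og g).mkQ A.omega) := by
  induction x using mkQ_fixed_induction hg with
  | add x x' hx hx' => rw [map_add, map_add, LinearMap.add_apply, hx, hx']
  | smul t x hx => rw [map_smul, map_smul, LinearMap.smul_apply, hx]
  | fixed n u hn hu =>
    have h := star_sub_star_smodEq_residue hg A.omega_mem hn (omega_mem_eigen g) hu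
    rw [show ((2 : ℤ) - 1 : ℂ) = 1 by norm_num] at h
    exact sub_smodEq_zero.1 (h.trans (SModEq.zero.2 (residue_omega_mem_Og hg hn hu)))

end Star

/-! ### The map `φ` -/

section Exponential

attribute [local instance] LieRing.ofAssociativeRing

variable (A : VertexOperatorAlgebra V)

theorem ad_L_one_mode {p : ℤ} {a : V} (ha : a ∈ A.wt p) (n : ℤ) :
    LieAlgebra.ad ℂ (Module.End ℂ V) (A.L 1) (A.mode a n) =
      (2 * p - n - 2 : ℂ) • A.mode a (n + 1) + A.mode (A.L 1 a) n := by
  ext w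
  rw [LieAlgebra.ad_apply, Ring.lie_def, LinearMap.sub_apply, Module.End.mul_apply,
    Module.End.mul_apply, A.L_one_mode ha, add_assoc, add_sub_cancel_left, LinearMap.add_apply,
    LinearMap.smul_apply]

theorem inv_factorial_smul_ad_L_one_pow_mode {p : ℤ} {a : V} (ha : a ∈ A.wt p) (n : ℤ) (N : ℕ) :
    (N.factorial : ℂ)⁻¹ • (LieAlgebra.ad ℂ (Module.End ℂ V) (A.L 1) ^ N) (A.mode a n) =
      ∑ q ∈ antidiagonal N,
        ((q.1.factorial : ℂ)⁻¹ * Ring.choose (2 * p - n - 2 - q.1 : ℂ) q.2) •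
          A.mode ((A.L 1 ^ q.1) a) (n + q.2) := by
  induction N generalizing p a n with
  | zero => simp
  | succ N ih =>
    have hL : A.L 1 a ∈ A.wt (p - 1) := by simpa using A.L_one_pow_mem ha 1
    have hN : (N + 1 : ℂ) ≠ 0 := N.cast_add_one_ne_zero
    have pow_L (j : ℕ) : (A.L 1 ^ j) (A.L 1 a) = (A.L 1 ^ (j + 1)) a := by
      rw [pow_succ, Module.End.mul_apply]
    have shift_n (k : ℕ) : n + 1 + k = n + (k + 1 : ℕ) := by lia
    rw [pow_succ, Module.End.mul_apply, A.ad_L_one_mode ha, map_add, map_smul, Nat.factorial_succ,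
      Nat.cast_mul, mul_inv, mul_smul, smul_add, smul_comm _ (2 * p - n - 2 : ℂ), ih ha, ih hL,
      Nat.cast_succ, inv_smul_eq_iff₀ hN, add_comm,
      succ_smul_sum_antidiagonal _ fun j k => A.mode ((A.L 1 ^ j) a) (n + k),
      show (2 * (p - 1 : ℤ) - n - 2 : ℂ) = 2 * p - n - 2 - 2 by push_cast; ring,
      show (2 * p - (n + 1 : ℤ) - 2 : ℂ) = 2 * p - n - 2 - 1 by push_cast; ring]
    simp only [pow_L, shift_n]

theorem exists_mode_L_one_pow_eq_zero {p q : ℤ} {a b : V} (ha : a ∈ A.wt p) (hb : b ∈ A.wt q)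
    (n : ℤ) : ∃ N : ℕ, ∀ j k i : ℕ, N ≤ j + k + i →
      A.mode ((A.L 1 ^ j) a) (n + k) ((A.L 1 ^ i) b) = 0 := by
  obtain ⟨M, hM⟩ := A.bounded_below
  refine ⟨(p + q - n - M).toNat, fun j k i h => ?_⟩
  have hwt := A.mode_mem_wt (A.L_one_pow_mem ha j) (A.L_one_pow_mem hb i) (n + k) rfl
  rwa [hM _ (by lia), Submodule.mem_bot] at hwt

theorem expL_apply (v : V) : A.expL v = ∑ᶠ j : ℕ, (j.factorial : ℂ)⁻¹ • (A.L 1 ^ j) v := rfl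

theorem expL_mode_eq_finsum_ad {p q : ℤ} {a b : V} (ha : a ∈ A.wt p) (hb : b ∈ A.wt q) (n : ℤ) :
    A.expL (A.mode a n b) = ∑ᶠ k : ℕ, ((k.factorial : ℂ)⁻¹ •
      (LieAlgebra.ad ℂ (Module.End ℂ V) (A.L 1) ^ k) (A.mode a n)) (A.expL b) := by
  obtain ⟨N, hN⟩ := A.exists_mode_L_one_pow_eq_zero ha hb n
  have ad_pow_eq_zero (k i : ℕ) (h : N ≤ k + i) : ((k.factorial : ℂ)⁻¹ •
      (LieAlgebra.ad ℂ (Module.End ℂ V) (A.L 1) ^ k) (A.mode a n))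
        ((i.factorial : ℂ)⁻¹ • (A.L 1 ^ i) b) = 0 := by
    rw [map_smul, A.inv_factorial_smul_ad_L_one_pow_mode ha, LinearMap.sum_apply,
      Finset.sum_eq_zero, smul_zero]
    intro q hq
    rw [LinearMap.smul_apply, hN _ _ _ (by rwa [mem_antidiagonal.1 hq]), smul_zero]
  have expand_expL := fun k : ℕ => map_finsum ((k.factorial : ℂ)⁻¹ •
    (LieAlgebra.ad ℂ (Module.End ℂ V) (A.L 1) ^ k) (A.mode a n)) (A.exp_finite b)
  simp only [expL_apply, expand_expL]
  rw [finsum_finsum_eq_finsum_antidiagonal ad_pow_eq_zero]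
  exact finsum_congr fun M => inv_factorial_smul_pow_apply _ _ _ _

theorem expL_mode {p q : ℤ} {a b : V} (ha : a ∈ A.wt p) (hb : b ∈ A.wt q) (n : ℤ) :
    A.expL (A.mode a n b) = ∑ᶠ j : ℕ, (j.factorial : ℂ)⁻¹ •
      A.residue (2 * p - n - 2 - j) n ((A.L 1 ^ j) a) (A.expL b) := by
  obtain ⟨N, hN⟩ := A.exists_mode_L_one_pow_eq_zero ha hb n
  have mode_expL_eq_zero (j k : ℕ) (h : N ≤ j + k) :
      A.mode ((A.L 1 ^ j) a) (n + k) (A.expL b) = 0 := by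
    rw [expL_apply, map_finsum _ (A.exp_finite b)]
    exact finsum_eq_zero_of_forall_eq_zero fun i => by rw [map_smul, hN _ _ _ (by lia), smul_zero]
  simp only [A.expL_mode_eq_finsum_ad ha hb, A.inv_factorial_smul_ad_L_one_pow_mode ha,
    residue_apply, smul_finsum, smul_smul]
  rw [finsum_finsum_eq_finsum_antidiagonal fun j k h => by
    rw [mode_expL_eq_zero j k h, smul_zero]]
  exact finsum_congr fun k => LinearMap.sum_apply _ _ _

theorem finsum_choose_smul_expL_mode {p q : ℤ} {a b : V} (ha : a ∈ A.wt p) (hb : b ∈ A.wt q)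
    (α : ℂ) (m : ℤ) :
    ∑ᶠ i : ℕ, ((-1 : ℂ) ^ i * Ring.choose α i) • A.expL (A.mode a (m + i) b) =
      ∑ᶠ j : ℕ, (j.factorial : ℂ)⁻¹ •
        A.residue (2 * p - m - 2 - j - α) m ((A.L 1 ^ j) a) (A.expL b) := by
  obtain ⟨J, hJ⟩ := A.L_one_locally_nilpotent a
  have summand_eq_zero (j : ℕ) (h : J ≤ j) (β : ℂ) (n : ℤ) (w : V) :
      (j.factorial : ℂ)⁻¹ • A.residue β n ((A.L 1 ^ j) a) w = 0 := by
    rw [hJ j h, map_zero, LinearMap.zero_apply, smul_zero]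
  have residue_finite (j : ℕ) : (Function.support fun i : ℕ => ((-1 : ℂ) ^ i * Ring.choose α i) •
      (j.factorial : ℂ)⁻¹ •
        A.residue (2 * p - m - 2 - j - i) (m + i) ((A.L 1 ^ j) a) (A.expL b)).Finite := by
    obtain ⟨N, hN⟩ := A.mode_eventually_zero ((A.L 1 ^ j) a) (A.expL b)
    refine (Set.finite_Iio (N - m).toNat).subset fun i hi => by_contra fun hNi => hi ?_
    rw [Set.mem_Iio] at hNi
    have residue_eq_zero (β : ℂ) :
        A.residue β (m + i) ((A.L 1 ^ j) a) (A.expL b) = 0 := by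
      rw [A.residue_eq_sum_range (N := 0) (fun n hn => hN n (by lia)) β, Finset.range_zero,
        Finset.sum_empty]
    simp only [residue_eq_zero, smul_zero]
  have exponent (i j : ℕ) :
      (2 * p - (m + i : ℤ) - 2 - j : ℂ) = 2 * p - m - 2 - j - i := by
    push_cast
    ring
  simp only [A.expL_mode ha hb, exponent,
    finsum_eq_sum_range fun j h => summand_eq_zero j h _ _ _, Finset.smul_sum]
  rw [finsum_sum_comm _ _ fun j _ => residue_finite j]
  refine Finset.sum_congr rfl fun j _ => ?_
  rw [← A.finsum_choose_smul_residue, smul_finsum]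
  exact finsum_congr fun i => smul_comm _ _ _

end Exponential

section Phi

variable (A : VertexOperatorAlgebra V)

theorem phi_apply {n : ℤ} {v : V} (hv : v ∈ A.wt n) : A.phi v = (-1 : ℂ) ^ n • A.expL v := by
  rw [phi, LinearMap.comp_apply, signL, A.extendByWeight_apply _ hv, LinearMap.smul_apply,
    LinearMap.id_apply, map_smul]

theorem phi_residue {p q : ℤ} {a b : V} (ha : a ∈ A.wt p) (hb : b ∈ A.wt q) (α : ℂ) (m : ℤ) :
    A.phi (A.residue α m a b) = (-1 : ℂ) ^ (p - m - 1) • ∑ᶠ j : ℕ, (j.factorial : ℂ)⁻¹ •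
      A.residue (2 * p - m - 2 - j - α) m ((A.L 1 ^ j) a) (A.phi b) := by
  have phi_mode (i : ℕ) : A.phi (A.mode a (m + i) b) =
      ((-1 : ℂ) ^ (p - m - 1) * (-1) ^ q * (-1) ^ i) • A.expL (A.mode a (m + i) b) := by
    rw [A.phi_apply (A.mode_mem_wt ha hb (m + i) rfl),
      ← zpow_add₀ (neg_ne_zero.2 one_ne_zero), ← neg_one_zpow_sub_natCast]
    congr 2
    ring
  rw [residue_apply, map_finsum _ (A.residue_finite α m a b), A.phi_apply hb]
  simp only [map_smul, phi_mode, smul_comm _ ((-1 : ℂ) ^ q), ← smul_finsum]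
  rw [← A.finsum_choose_smul_expL_mode ha hb, smul_finsum, smul_finsum]
  refine finsum_congr fun i => ?_
  rw [smul_smul, smul_smul, smul_smul]
  ring_nf

theorem phi_phi_of_mem_wt {n : ℤ} {v : V} (hv : v ∈ A.wt n) : A.phi (A.phi v) = v := by
  obtain ⟨J, hJ⟩ := A.L_one_locally_nilpotent v
  have phi_L_one_pow (j : ℕ) : A.phi ((j.factorial : ℂ)⁻¹ • (A.L 1 ^ j) v) =
      (-1 : ℂ) ^ n • ∑ᶠ i : ℕ, ((-1) ^ j * (j.factorial : ℂ)⁻¹ * (i.factorial : ℂ)⁻¹) •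
        (A.L 1 ^ (j + i)) v := by
    rw [map_smul, A.phi_apply (A.L_one_pow_mem hv j), expL_apply, neg_one_zpow_sub_natCast,
      mul_smul, smul_comm, smul_finsum, smul_finsum]
    refine congrArg _ (finsum_congr fun i => ?_)
    rw [add_comm, pow_add, Module.End.mul_apply, smul_smul, smul_smul,
      mul_comm ((-1 : ℂ) ^ j)]
  have antidiagonal_sum (N : ℕ) : ∑ q ∈ antidiagonal N,
      ((-1) ^ q.1 * (q.1.factorial : ℂ)⁻¹ * (q.2.factorial : ℂ)⁻¹) • (A.L 1 ^ (q.1 + q.2)) v =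
        (if N = 0 then 1 else 0 : ℂ) • (A.L 1 ^ N) v := by
    rw [Finset.sum_congr rfl fun q hq => by rw [mem_antidiagonal.1 hq], ← Finset.sum_smul,
      sum_antidiagonal_neg_one_pow_inv_factorial]
  rw [A.phi_apply hv, map_smul, expL_apply, map_finsum _ (A.exp_finite v)]
  simp only [phi_L_one_pow, ← smul_finsum]
  rw [finsum_finsum_eq_finsum_antidiagonal (N := J) fun j i h => by rw [hJ _ h, smul_zero],
    smul_smul, ← mul_zpow, neg_one_mul, neg_neg, one_zpow, one_smul]
  simp only [antidiagonal_sum]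
  rw [finsum_eq_single _ 0 fun N hN => by rw [if_neg hN, zero_smul], if_pos rfl, one_smul,
    pow_zero, Module.End.one_apply]

theorem phi_mem_of_forall_L_one_pow_mem (S : Submodule ℂ V) {n : ℤ} {v : V} (hv : v ∈ A.wt n)
    (h : ∀ j, (A.L 1 ^ j) v ∈ S) : A.phi v ∈ S := by
  rw [A.phi_apply hv, expL_apply]
  exact S.smul_mem _ (finsum_mem_of_forall_mem S fun j => S.smul_mem _ (h j))

end Phi

section AntiIsomorphism

variable {A : VertexOperatorAlgebra V} {g : A.Aut}

theorem phi_phi (hg : IsOfFinOrder g) (v : V) : A.phi (A.phi v) = v :=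
  mem_of_homogeneous_mem hg ((A.phi ∘ₗ A.phi).eqLocus LinearMap.id)
    (fun _ _ _ _ hn _ => A.phi_phi_of_mem_wt hn) v

theorem phi_circ_mem_Og_inv (hg : IsOfFinOrder g) {n : ℤ} {r : ℕ} {a : V} (hr : r < orderOf g)
    (hn : a ∈ A.wt n) (ha : a ∈ A.eigen g r) (b : V) : A.phi (A.circ g n r a b) ∈ A.Og g⁻¹ := by
  obtain ⟨s, hs, hrs⟩ : ∃ s < orderOf g, orderOf g ∣ r + s :=
    ⟨(orderOf g - r) % orderOf g, Nat.mod_lt _ hg.orderOf_pos,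
      Nat.dvd_of_mod_eq_zero (by
        rw [Nat.add_mod_mod, Nat.add_sub_cancel' hr.le, Nat.mod_self])⟩
  obtain ⟨delta_eq, sum_eq⟩ := delta_add_div_add_div hr hs hrs
  rw [circ_eq_residue, ← LinearMap.comp_apply, ← Submodule.mem_comap]
  refine mem_of_homogeneous_mem hg _ (fun q _ b _ hq _ => ?_) b
  rw [Submodule.mem_comap, LinearMap.comp_apply, A.phi_residue hn hq]
  refine Submodule.smul_mem _ _ (finsum_mem_of_forall_mem _ fun j => Submodule.smul_mem _ _ ?_)
  refine residue_mem_Og (by rwa [orderOf_inv]) (A.L_one_pow_mem hn j)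
    (L_one_pow_mem_eigen (mem_eigen_inv hg hrs ha) j) _ (le_refl 0) ?_ ?_
  · rw [delta_eq, orderOf_inv]
    push_cast
    linear_combination -sum_eq
  · rw [delta_eq, Nat.cast_zero, sub_zero]

theorem phi_mem_Og_inv (hg : IsOfFinOrder g) {x : V} (hx : x ∈ A.Og g) :
    A.phi x ∈ A.Og g⁻¹ := by
  suffices A.Og g ≤ (A.Og g⁻¹).comap A.phi from this hx
  refine Submodule.span_le.2 ?_
  rintro _ ⟨n, r, a, b, hr, hn, ha, rfl⟩
  exact phi_circ_mem_Og_inv hg hr hn ha b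

theorem residue_phi_smodEq_star (hg : IsOfFinOrder g) {n q : ℤ} {a b : V} (ha : a ∈ A.wt n)
    (hb : b ∈ A.wt q) (ha' : a ∈ A.eigen g 0) (hb' : b ∈ A.eigen g 0) :
    A.residue (n - 1) (-1) a (A.phi b) ≡ A.star g (A.phi b) a [SMOD A.Og g] :=
  A.phi_mem_of_forall_L_one_pow_mem
    (((A.Og g).mkQ ∘ₗ A.residue (n - 1) (-1) a).eqLocus ((A.Og g).mkQ ∘ₗ (A.star g).flip a)) hb
    fun j => residue_smodEq_star hg ha (A.L_one_pow_mem hb j) ha' (L_one_pow_mem_eigen hb' j)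

theorem phi_star_smodEq (hg : IsOfFinOrder g) {n q : ℤ} {a b : V} (ha : a ∈ A.wt n)
    (hb : b ∈ A.wt q) (ha' : a ∈ A.eigen g 0) (hb' : b ∈ A.eigen g 0) :
    A.phi (A.star g a b) ≡ A.star g⁻¹ (A.phi b) (A.phi a) [SMOD A.Og g⁻¹] := by
  obtain ⟨J, hJ⟩ := A.L_one_locally_nilpotent a
  have mem_inv {u : V} (hu : u ∈ A.eigen g 0) : u ∈ A.eigen g⁻¹ 0 :=
    mem_eigen_inv hg (dvd_zero _) hu
  rw [star_eq_residue hg ha ha', A.phi_residue ha hb, A.phi_apply ha, map_smul,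
    show n - -1 - 1 = n by ring, expL_apply, map_finsum _ (A.exp_finite a),
    finsum_eq_sum_range (N := J), finsum_eq_sum_range (N := J)]
  · refine (SModEq.sum fun j _ => ?_).smul _
    have h := residue_phi_smodEq_star hg.inv (A.L_one_pow_mem ha j) hb
      (L_one_pow_mem_eigen (mem_inv ha') j) (mem_inv hb')
    rw [map_smul, show (2 * n - (-1 : ℤ) - 2 - j - n : ℂ) = (n - j : ℤ) - 1 by push_cast; ring]
    exact h.smul _
  · intro j hj
    rw [hJ j hj, smul_zero, map_zero]
  · intro j hj
    rw [hJ j hj, map_zero, LinearMap.zero_apply, smul_zero]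

variable (A g) in
/-- The anti-isomorphism `A_g(V) → A_{g⁻¹}(V)` induced by `φ`. -/
def phiQuotient (hg : IsOfFinOrder g) : A.Ag g ≃ₗ[ℂ] A.Ag g⁻¹ :=
  LinearEquiv.ofLinearMap
    ((A.Og g).mapQ (A.Og g⁻¹) A.phi fun _ hx => phi_mem_Og_inv hg hx)
    ((A.Og g⁻¹).mapQ (A.Og g) A.phi fun _ hx =>
      inv_inv g ▸ phi_mem_Og_inv hg.inv hx)
    (by
      ext x
      simp [phi_phi hg])
    (by
      ext x
      simp [phi_phi hg])

theorem phiQuotient_mkQ (hg : IsOfFinOrder g) (a : V) :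
    A.phiQuotient g hg ((A.Og g).mkQ a) = (A.Og g⁻¹).mkQ (A.phi a) := rfl

theorem phiQuotient_starQuotient (hg : IsOfFinOrder g) (x y : A.Ag g) :
    A.phiQuotient g hg (A.starQuotient g hg x y) =
      A.starQuotient g⁻¹ hg.inv (A.phiQuotient g hg y) (A.phiQuotient g hg x) := by
  induction x using mkQ_fixed_induction hg with
  | add x x' hx hx' => simp only [map_add, LinearMap.add_apply, hx, hx']
  | smul t x hx => simp only [map_smul, LinearMap.smul_apply, hx]
  | fixed n a ha ha' =>
  induction y using mkQ_fixed_induction hg with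
  | add y y' hy hy' => simp only [map_add, LinearMap.add_apply, hy, hy']
  | smul t y hy => simp only [map_smul, LinearMap.smul_apply, hy]
  | fixed q b hb hb' => exact phi_star_smodEq hg ha hb ha' hb'

end AntiIsomorphism

end VertexOperatorAlgebra

end

theorem theorem2p4 {V : Type*} [AddCommGroup V] [Module ℂ V] (A : VertexOperatorAlgebra V)
    (g : A.Aut) (hg : IsOfFinOrder g) :
    -- the products induced by `*_g` on `A_g(V)` and by `*_{g⁻¹}` on `A_{g⁻¹}(V)`
    ∃ (μ : A.Ag g →ₗ[ℂ] A.Ag g →ₗ[ℂ] A.Ag g)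
      (μ' : A.Ag g⁻¹ →ₗ[ℂ] A.Ag g⁻¹ →ₗ[ℂ] A.Ag g⁻¹),
      (∀ u v : V, μ ((A.Og g).mkQ u) ((A.Og g).mkQ v) = (A.Og g).mkQ (A.star g u v)) ∧
      (∀ u v : V, μ' ((A.Og g⁻¹).mkQ u) ((A.Og g⁻¹).mkQ v) =
        (A.Og g⁻¹).mkQ (A.star g⁻¹ u v)) ∧
      -- (i) they are associative
      (∀ x y z : A.Ag g, μ (μ x y) z = μ x (μ y z)) ∧
      (∀ x y z : A.Ag g⁻¹, μ' (μ' x y) z = μ' x (μ' y z)) ∧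
      -- (ii) `φ` induces an anti-isomorphism
      (∃ Φ : A.Ag g ≃ₗ[ℂ] A.Ag g⁻¹,
        (∀ a : V, Φ ((A.Og g).mkQ a) = (A.Og g⁻¹).mkQ (A.phi a)) ∧
        (∀ x y : A.Ag g, Φ (μ x y) = μ' (Φ y) (Φ x))) ∧
      -- (iii) the vacuum is an identity and `ω` is central modulo `O_g(V)`
      (∀ x : V, A.star g A.vacuum x ≡ x [SMOD A.Og g] ∧ A.star g x A.vacuum ≡ x [SMOD A.Og g]) ∧
      (∀ x : V, A.star g A.omega x ≡ A.star g x A.omega [SMOD A.Og g]) := by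
  open VertexOperatorAlgebra in
  exact ⟨A.starQuotient g hg, A.starQuotient g⁻¹ hg.inv,
    starQuotient_mkQ hg, starQuotient_mkQ hg.inv,
    starQuotient_assoc hg, starQuotient_assoc hg.inv,
    ⟨A.phiQuotient g hg, phiQuotient_mkQ hg, phiQuotient_starQuotient hg⟩,
    fun x => ⟨by rw [vacuum_star hg], starQuotient_vacuum hg ((A.Og g).mkQ x)⟩,
    fun x => starQuotient_omega_comm hg ((A.Og g).mkQ x)⟩
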